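/- **Setting.** Let $A$ be a finite alphabet and let $\sigma:A\to A^+$ be a substitution (a map into the nonempty words, extended to words by concatenation). Suppose that $\sigma$ is *of $n$ primitive components*: there are $\emptyset=A_0\subsetneq A_1\subsetneq\dots\subsetneq A_n=A$ such that $\sigma(a)\in A_j^+$ for all $a\in A_j$, $1\le j\le n$, and there is $k\ge 1$ such that for all $1\le j\le n$, $a\in A_j\setminus A_{j-1}$ and $b\in A_j$, the letter $b$ occurs in $\sigma^k(a)$. For words $u\neq\Lambda$ and $w$, $N(u,w)$ is the number of occurrences of $u$ as a factor of $w$. Let $\mathcal L(\sigma_j)$ be the set of factors of the words $\sigma^k(a)$ with $k\ge1$, $a\in A_j$ (so $\mathcal L(\sigma_0)=\emptyset$), and $\mathcal L_m(\sigma_j)$ its subset of words of length $m$. Let $\mathcal B_m(j)=\{u\in\mathcal L_m(\sigma_{j+1}) : u_1\in A_j\}$. Let $\theta_j$ be the dominant eigenvalue of the primitive matrix $(N(b,\sigma(a)))_{a,b\in A_j\setminus A_{j-1}}$, i.e. the eigenvalue larger than the modulus of every other eigenvalue, and let $\lambda_r=\max_{1\le j\le r}\theta_j$. For $m\ge1$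 let $\sigma^{(m)}$ be the substitution that maps a word $u$ of length $m$ in $\mathcal L(\sigma)$ to the sequence of the factors of length $m$ of $\sigma(u)$ that start at the positions $1,\dots,|\sigma(u_1)|$, and for a set $S$ of such words let $M^{(m)}_S$ be the $S\times S$ matrix whose $(u,v)$-entry is the number of times that $v$ appears in $\sigma^{(m)}(u)$. For $1<i\le n$ let $I=\{1\le i_0<i:\ \theta_{i_1}<\theta_i \text{ for all } i_0\le i_1<i\}$, and let $i'=i$ if $I=\emptyset$ and $i'=\min I$ otherwise. **Corollary 5.1.** Let $1<i\le n$, suppose $\theta_i>1$, and let $m\ge1$. (i) Suppose $\theta_i>\lambda_{i-1}$. Then $M^{(m)}_{\mathcal L_m(\sigma_i)}$ has a left eigenvector for $\theta_i$ all of whose entries are positive, and for every left eigenvector $\beta$ of this matrix for $\theta_i$, every $a\in A_i\setminus A_{i-1}$ and every $v\in\mathcal L_m(\sigma_i)$, $$\lim_{k\to\infty}\frac{N(v,\sigma^k(a))}{|\sigma^k(a)|}=\frac{\beta_v}{\sum_{w\in\mathcal L_m(\sigma_i)}\beta_w}.$$ Moreover, there is a left eigenvector $\delta=(\delta_v)$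 of $M^{(m)}_{\mathcal L_m(\sigma_i)\setminus\mathcal L_m(\sigma_{i'-1})}$ for $\theta_i$, all of whose entries are positive, for which (ii) and (iii) hold. (ii) If $\theta_i\le\lambda_{i-1}$, then there are numbers $\gamma_u>0$, $u\in\mathcal L_m(\sigma_i)\setminus\mathcal B_m(i-1)$, such that for every $a\in A_i\setminus A_{i-1}$, every $v\in\mathcal L_m(\sigma_i)$ and every $u\in\mathcal L_m(\sigma_i)$ with $u_1=a$, $$\lim_{k\to\infty}\frac{1}{\theta_i^{\,k}}N(v,\sigma^k(a))=\begin{cases}\infty&\text{if }v\in\mathcal L_m(\sigma_{i'-1}),\\ \gamma_u\delta_v&\text{otherwise.}\end{cases}$$ (iii) For every $a\in A_i\setminus A_{i-1}$ and every $v\in\mathcal L_m(\sigma_i)\setminus\mathcal L_m(\sigma_{i'-1})$, $$\lim_{k\to\infty}\frac{N(v,\sigma^k(a))}{\sum_{b\in A_i\setminus A_{i-1}}N(b,\sigma^k(a))}=\frac{\delta_v}{\sum_{w\in\mathcal L_m(\sigma_i)\setminus\mathcal B_m(i-1)}\delta_w}.$$ -/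

import Mathlib

open Filter Topology

namespace PrimitiveComponents

section Words

variable {A : Type*}

/-- The extension of a substitution `σ : A → A⁺` to words, by concatenation. -/
def substWord (σ : A → List A) (w : List A) : List A := w.flatMap σ

/-- The `k`-word `σ^k(a)`. -/
def iter (σ : A → List A) (k : ℕ) (a : A) : List A := (substWord σ)^[k] [a]

/-- `N(u, v)`: the number of occurrences of the nonempty word `u` in `v`
(an occurrence being a position at which `u` can be read in `v`). -/
def occ [DecidableEq A] (u v : List A) : ℕ :=
  ((Finset.range v.length).filter fun j => u <+: v.drop j).card

/-- `σ` is a substitution of `n` primitive components, with associated sequence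
`∅ = F 0 ⊊ F 1 ⊊ ⋯ ⊊ F n = A` of subalphabets. -/
structure IsOfPrimitiveComponents [Fintype A] [DecidableEq A]
    (σ : A → List A) (n : ℕ) (F : ℕ → Finset A) : Prop where
  /-- the images of letters are nonempty words -/
  ne_nil : ∀ a, σ a ≠ []
  bot : F 0 = ∅
  top : F n = Finset.univ
  strict : ∀ j < n, F j ⊂ F (j + 1)
  closed : ∀ j, 1 ≤ j → j ≤ n → ∀ a ∈ F j, ∀ b ∈ σ a, b ∈ F j
  reach : ∃ k, 1 ≤ k ∧ ∀ j, 1 ≤ j → j ≤ n →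
    ∀ a ∈ F j \ F (j - 1), ∀ b ∈ F j, b ∈ iter σ k a

/-- The language of the restriction of `σ` to the `σ`-closed subalphabet `S`: all factors of the
words `σ^k(a)` with `k ≥ 1` and `a ∈ S`. With `S = F j` this is `ℒ(σ_j)`; it is empty for
`S = ∅`. -/
def lang (σ : A → List A) (S : Finset A) : Set (List A) :=
  {w | ∃ k, 1 ≤ k ∧ ∃ a ∈ S, w <:+: iter σ k a}

open Classical in
/-- The words of length `m` in `lang σ S`. With `S = F j` this is `ℒ_m(σ_j)`. -/
noncomputable def langOfLength [Fintype A] (σ : A → List A) (S : Finset A) (m : ℕ) :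
    Finset (List A) :=
  (List.finite_length_eq A m).toFinset.filter fun w => w ∈ lang σ S

/-- `ℬ_m(j)`: the words of `ℒ_m(σ_{j+1})` whose first letter is in `F j`. -/
noncomputable def startWords [Fintype A] [DecidableEq A] (σ : A → List A) (F : ℕ → Finset A)
    (m j : ℕ) : Finset (List A) :=
  (langOfLength σ (F (j + 1)) m).filter fun u => ∃ b ∈ F j, u.head? = some b

/-- The auxiliary substitution `σ^(m)`, whose letters are words of length `m`: it maps `u` to the
sequence of the factors of length `m` of `σ(u)` that start at the positions `1, …, |σ(u₁)|`. -/
def blockSubst (σ : A → List A) (m : ℕ) : List A → List (List A)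
  | [] => []
  | a :: w => (List.range (σ a).length).map fun j => ((substWord σ (a :: w)).drop j).take m

end Words

section Matrices

/-- The `S × S` block of the incidence matrix of a substitution `τ`: its `(a, b)`-entry is the
number of occurrences of the letter `b` in `τ(a)`. -/
def incidence {B : Type*} [DecidableEq B] (τ : B → List B) (S : Finset B) : Matrix S S ℝ :=
  fun a b => ((τ (a : B)).count (b : B) : ℝ)

/-- `μ` is an eigenvalue of `M`, and every other complex eigenvalue has modulus less than `μ`. -/
def IsDominantEigenvalue {ι : Type*} [Fintype ι] [DecidableEq ι] (M : Matrix ι ι ℝ) (μ : ℝ) :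
    Prop :=
  (μ : ℂ) ∈ spectrum ℂ (M.map (fun x : ℝ => (x : ℂ))) ∧
    ∀ η ∈ spectrum ℂ (M.map (fun x : ℝ => (x : ℂ))), η ≠ (μ : ℂ) → ‖η‖ < μ

open Classical in
/-- The dominant eigenvalue of `M` (it is unique if it exists; every primitive matrix has one). -/
noncomputable def dominantEigenvalue {ι : Type*} [Fintype ι] [DecidableEq ι]
    (M : Matrix ι ι ℝ) : ℝ :=
  if h : ∃ μ, IsDominantEigenvalue M μ then h.choose else 0

/-- `x` is a left (row) eigenvector of `M` for `μ`. -/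
def IsLeftEigenvector {ι : Type*} [Fintype ι] (M : Matrix ι ι ℝ) (μ : ℝ) (x : ι → ℝ) : Prop :=
  x ≠ 0 ∧ Matrix.vecMul x M = μ • x

end Matrices

section Eigenvalues

variable {A : Type*} [DecidableEq A]

/-- `θ_j`: the dominant eigenvalue of the diagonal block of the incidence matrix of `σ` that
belongs to the letters of `F j \ F (j - 1)`. -/
noncomputable def theta (σ : A → List A) (F : ℕ → Finset A) (j : ℕ) : ℝ :=
  dominantEigenvalue (incidence σ (F j \ F (j - 1)))

/-- `λ_r = max {θ_j | 1 ≤ j ≤ r}` for `r ≥ 1`. -/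
noncomputable def lam (σ : A → List A) (F : ℕ → Finset A) (r : ℕ) : ℝ :=
  sSup (theta σ F '' Set.Icc 1 r)

/-- The set of all `i₀` with `1 ≤ i₀ < i` such that `θ_{i₁} < θ_i` whenever `i₀ ≤ i₁ < i`. -/
def indexSet (σ : A → List A) (F : ℕ → Finset A) (i : ℕ) : Set ℕ :=
  {i₀ | 1 ≤ i₀ ∧ i₀ < i ∧ ∀ i₁, i₀ ≤ i₁ → i₁ < i → theta σ F i₁ < theta σ F i}

open Classical in
/-- `i'`: the least element of `indexSet σ F i`, or `i` if that set is empty. -/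
noncomputable def iPrime (σ : A → List A) (F : ℕ → Finset A) (i : ℕ) : ℕ :=
  if (indexSet σ F i).Nonempty then sInf (indexSet σ F i) else i

/-- `ℒ_m(σ_i) \ ℒ_m(σ_{i'-1})`, the index set of the numbers `δ_v`. -/
noncomputable abbrev deltaWords [Fintype A] (σ : A → List A) (F : ℕ → Finset A) (i m : ℕ) :
    Finset (List A) :=
  langOfLength σ (F i) m \ langOfLength σ (F (iPrime σ F i - 1)) m

/-- `ℒ_m(σ_i) \ ℬ_m(i-1)`, the index set of the numbers `γ_u`. -/
noncomputable abbrev gammaWords [Fintype A] (σ : A → List A) (F : ℕ → Finset A) (i m : ℕ) :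
    Finset (List A) :=
  langOfLength σ (F i) m \ startWords σ F m (i - 1)

end Eigenvalues

end PrimitiveComponents

open PrimitiveComponents

/-! Fix a lower level `l`: 0 when `θ_i` exceeds all lower eigenvalues, `i' - 1` in general. The
levels strictly between `l` and `i` have eigenvalues below `θ_i`, and for `l = i' - 1` either `l =
0` or `θ_l ≥ θ_i` (`iPrime_spec`). Let `M` be the incidence matrix of `σ^(m)` on the words of
`ℒ_m(σ_i)` outside `ℒ_m(σ_l)`. The `(u, v)`-entry of `M ^ k` counts the occurrences of `v` in
`σ^k(u)` that start in `σ^k(u₁)` (`incidence_pow_apply`).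

`M` need not be irreducible, but a Perron eigenvector `x` of the `i`-th diagonal block, read on
first letters, is a nonnegative right eigenvector of `M`. Words starting in component `i` reach
every index, words starting lower grow strictly more slowly than `θ_i^k`
(`exists_occWith_le_lower`), and no entry exceeds a multiple of `θ_i^k` (`exists_occWith_le`). Hence
`M ^ k / θ_i^k` tends to the rank-one matrix with entries `x_{u₁} δ_v`, where `δ` is a positive left
eigenvector (`exists_left_eigenvector_tendsto`).

The finite limits follow: letters are counted through the words of length `m` that they begin
(`sum_occWith`), and `x_a` cancels in the quotients. If `θ_l ≥ θ_i`, component `i` keeps feeding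
component `l`, which makes the counts of the words of `ℒ_m(σ_l)` outgrow `θ_i^k`
(`tendsto_occWith_atTop`). -/

namespace PrimitiveComponents

/-! ### Powers of nonnegative matrices and Perron–Frobenius theory -/

section LinearAlgebra

open Matrix

variable {ι : Type*} [Fintype ι]

theorem mulVec_pos {M : Matrix ι ι ℝ} (hM : ∀ u v, 0 < M u v) {y : ι → ℝ} (hy : ∀ u, 0 ≤ y u)
    (hne : y ≠ 0) (u : ι) : 0 < (M *ᵥ y) u := by
  obtain ⟨w, hw⟩ := Function.ne_iff.1 hne
  exact Finset.sum_pos' (fun v _ => mul_nonneg (hM u v).le (hy v))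
    ⟨w, Finset.mem_univ w, mul_pos (hM u w) ((hy w).lt_of_ne' hw)⟩

variable [DecidableEq ι]

theorem pow_apply_nonneg {T : Matrix ι ι ℝ} (hT : ∀ u v, 0 ≤ T u v) (k : ℕ) :
    ∀ u v, 0 ≤ (T ^ k) u v := by
  induction k with
  | zero => intro u v; rw [pow_zero, one_apply]; split_ifs <;> norm_num
  | succ k ih =>
    intro u v
    rw [pow_succ, mul_apply]
    exact Finset.sum_nonneg fun w _ => mul_nonneg (ih u w) (hT w v)

theorem pow_mulVec_of_eigenvector {R : Type*} [CommRing R] {T : Matrix ι ι R} {t : R} {x : ι → R}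
    (h : T *ᵥ x = t • x) (k : ℕ) : (T ^ k) *ᵥ x = t ^ k • x := by
  induction k with
  | zero => simp
  | succ k ih => rw [pow_succ, ← mulVec_mulVec, h, mulVec_smul, ih, smul_smul, pow_succ']

theorem vecMul_pow_of_eigenvector {R : Type*} [CommRing R] {T : Matrix ι ι R} {t : R} {x : ι → R}
    (h : x ᵥ* T = t • x) (k : ℕ) : x ᵥ* (T ^ k) = t ^ k • x := by
  induction k with
  | zero => simp
  | succ k ih => rw [pow_succ, ← vecMul_vecMul, ih, smul_vecMul, h, smul_smul, pow_succ]

/-- Powers of a nonnegative matrix with a nonnegative fixed vector `x`, all of whose entries are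
reached from the support of `x`: the rows in the support of `x` become proportional to `x`. -/
theorem exists_tendsto_pow_of_fixed {T : Matrix ι ι ℝ} {x : ι → ℝ}
    (hT : ∀ u v, 0 ≤ T u v) (hx : ∀ u, 0 ≤ x u) (hne : ∃ u, 0 < x u)
    (hfix : T *ᵥ x = x) (hpos : ∀ v, ∃ K : ℕ, ∀ u, 0 < x u → 0 < (T ^ K) u v)
    (v : ι) (hbdd : ∀ u, ∃ C, ∀ k : ℕ, (T ^ k) u v ≤ C)
    (hzero : ∀ u, x u = 0 → Tendsto (fun k : ℕ => (T ^ k) u v) atTop (𝓝 0)) :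
    ∃ d, ∀ u, Tendsto (fun k : ℕ => (T ^ k) u v) atTop (𝓝 (x u * d)) := by
  classical
  obtain ⟨u₀, hu₀⟩ := hne
  have hfixk : ∀ k : ℕ, (T ^ k) *ᵥ x = x := fun k => by
    simpa using pow_mulVec_of_eigenvector (t := (1 : ℝ)) (by simpa using hfix) k
  have : Nonempty {u // 0 < x u} := ⟨⟨u₀, hu₀⟩⟩
  -- `m k` is the least ratio of column `v` of `T ^ k` to `x` over the support of `x`. It is
  -- nondecreasing because `T` is nonnegative and fixes `x`; its limit is the required `d`.
  set m : ℕ → ℝ := fun k => ⨅ u : {u // 0 < x u}, (T ^ k) u v / x u with hm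
  have hnn := pow_apply_nonneg hT
  have hmle : ∀ k u, 0 ≤ (T ^ k) u v - m k * x u := by
    intro k u
    rcases (hx u).eq_or_lt with h | h
    · rw [← h, mul_zero, sub_zero]; exact hnn k u v
    · have := ciInf_le (Finite.bddBelow_range fun u : {u // 0 < x u} => (T ^ k) u v / x u) ⟨u, h⟩
      have h2 : m k ≤ (T ^ k) u v / x u := this
      rw [le_div_iff₀ h] at h2
      linarith
  have hstep : ∀ k l u w, (T ^ l) u w * ((T ^ k) w v - m k * x w) ≤
      (T ^ (k + l)) u v - m k * x u := by
    intro k l u w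
    have h1 : (T ^ (k + l)) u v - m k * x u = ∑ w, (T ^ l) u w * ((T ^ k) w v - m k * x w) := by
      rw [add_comm, pow_add, mul_apply]
      conv_lhs => rw [← congrFun (hfixk l) u]
      simp only [mulVec, dotProduct, mul_sub, Finset.sum_sub_distrib, Finset.mul_sum]
      congr 1
      exact Finset.sum_congr rfl fun w _ => by ring
    rw [h1]
    exact Finset.single_le_sum (f := fun w => (T ^ l) u w * ((T ^ k) w v - m k * x w))
      (fun w _ => mul_nonneg (hnn l u w) (hmle k w)) (Finset.mem_univ w)
  have hmono : Monotone m := by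
    refine monotone_nat_of_le_succ fun k => le_ciInf fun u => ?_
    rw [le_div_iff₀ u.2]
    have := (mul_nonneg (hnn 1 u u) (hmle k u)).trans (hstep k 1 u u)
    linarith
  obtain ⟨C, hC⟩ := hbdd u₀
  have hbd : BddAbove (Set.range m) := by
    refine ⟨C / x u₀, ?_⟩
    rintro _ ⟨k, rfl⟩
    rw [le_div_iff₀ hu₀]
    linarith [hmle k u₀, hC k]
  have hlim := tendsto_atTop_ciSup hmono hbd
  refine ⟨⨆ k, m k, fun w => ?_⟩
  rcases (hx w).eq_or_lt with h | h
  · rw [← h, zero_mul]; exact hzero w h.symm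
  obtain ⟨K, hK⟩ := hpos w
  obtain ⟨ε, hε, hε'⟩ : ∃ ε > 0, ∀ u : {u // 0 < x u}, ε ≤ (T ^ K) u w / x u := by
    obtain ⟨u, hu⟩ := Finite.exists_min fun u : {u // 0 < x u} => (T ^ K) u w / x u
    exact ⟨_, div_pos (hK u u.2) u.2, hu⟩
  -- `T ^ K` spreads the excess at `w` to every row of the support, so the minimum rises by at least
  -- `ε` times that excess. As `m` converges, the excess tends to 0.
  have hgap : ∀ k, m k + ε * ((T ^ k) w v - m k * x w) ≤ m (k + K) := by
    intro k
    refine le_ciInf fun u => ?_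
    rw [le_div_iff₀ u.2]
    have h1 := hstep k K u w
    have h2 := hε' u
    rw [le_div_iff₀ u.2] at h2
    have h3 := mul_le_mul_of_nonneg_right h2 (hmle k w)
    nlinarith
  have hdiff : Tendsto (fun k => (m (k + K) - m k) / ε) atTop (𝓝 0) := by
    have := (((tendsto_add_atTop_iff_nat K).2 hlim).sub hlim).div_const ε
    simpa using this
  have hg : Tendsto (fun k => (T ^ k) w v - m k * x w) atTop (𝓝 0) := by
    refine squeeze_zero (fun k => hmle k w) (fun k => ?_) hdiff
    rw [le_div_iff₀ hε]
    linarith [hgap k]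
  have := hg.add (hlim.mul_const (x w))
  simpa [mul_comm] using this

/-- Asymptotics of the powers of a nonnegative matrix with a nonnegative eigenvector `x`, all of
whose entries are reached from the support of `x`, and whose other rows grow more slowly. -/
theorem exists_left_eigenvector_tendsto {M : Matrix ι ι ℝ} {θ : ℝ} {x : ι → ℝ} (hθ : 0 < θ)
    (hM : ∀ u v, 0 ≤ M u v) (hx : ∀ u, 0 ≤ x u) (hne : ∃ u, 0 < x u)
    (heig : M *ᵥ x = θ • x) (hpos : ∀ v, ∃ K : ℕ, ∀ u, 0 < x u → 0 < (M ^ K) u v)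
    (hbdd : ∀ u v, ∃ C, ∀ k : ℕ, (M ^ k) u v ≤ C * θ ^ k)
    (hzero : ∀ u v, x u = 0 → Tendsto (fun k : ℕ => (M ^ k) u v / θ ^ k) atTop (𝓝 0)) :
    ∃ δ : ι → ℝ, (∀ v, 0 < δ v) ∧ δ ᵥ* M = θ • δ ∧
      ∀ u v, Tendsto (fun k : ℕ => (M ^ k) u v / θ ^ k) atTop (𝓝 (x u * δ v)) := by
  have hT : ∀ (k : ℕ) u v, ((θ⁻¹ • M) ^ k) u v = (M ^ k) u v / θ ^ k := by
    intro k u v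
    rw [smul_pow, Matrix.smul_apply, smul_eq_mul, inv_pow, div_eq_inv_mul]
  have key : ∀ v, ∃ d, ∀ u, Tendsto (fun k : ℕ => (M ^ k) u v / θ ^ k) atTop (𝓝 (x u * d)) := by
    intro v
    have := exists_tendsto_pow_of_fixed (T := θ⁻¹ • M) (x := x)
      (fun u v => by simpa using mul_nonneg (inv_nonneg.2 hθ.le) (hM u v)) hx hne
      (by rw [smul_mulVec, heig, smul_smul, inv_mul_cancel₀ hθ.ne', one_smul])
      (fun v => ?_) v (fun u => ?_) (fun u hu => ?_)
    · simpa only [hT] using this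
    · obtain ⟨K, hK⟩ := hpos v
      exact ⟨K, fun u hu => by rw [hT]; exact div_pos (hK u hu) (pow_pos hθ K)⟩
    · obtain ⟨C, hC⟩ := hbdd u v
      exact ⟨C, fun k => by rw [hT, div_le_iff₀ (pow_pos hθ k)]; exact hC k⟩
    · simpa only [hT] using hzero u v hu
  choose δ hδ using key
  obtain ⟨u₀, hu₀⟩ := hne
  have hnonneg : ∀ v, 0 ≤ δ v := fun v => by
    have h1 : 0 ≤ x u₀ * δ v := ge_of_tendsto' (hδ v u₀) fun k =>
      div_nonneg (pow_apply_nonneg hM k u₀ v) (pow_pos hθ k).le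
    exact nonneg_of_mul_nonneg_right h1 hu₀
  have heig' : δ ᵥ* M = θ • δ := by
    ext v
    have h1 : Tendsto (fun k : ℕ => (M ^ (k + 1)) u₀ v / θ ^ (k + 1) * θ) atTop
        (𝓝 (x u₀ * δ v * θ)) := ((tendsto_add_atTop_iff_nat 1).2 (hδ v u₀)).mul_const θ
    have h2 : Tendsto (fun k : ℕ => ∑ w, (M ^ k) u₀ w / θ ^ k * M w v) atTop
        (𝓝 (∑ w, x u₀ * δ w * M w v)) :=
      tendsto_finsetSum _ fun w _ => (hδ w u₀).mul_const _
    have h3 : (fun k : ℕ => (M ^ (k + 1)) u₀ v / θ ^ (k + 1) * θ) =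
        fun k : ℕ => ∑ w, (M ^ k) u₀ w / θ ^ k * M w v := by
      ext k
      rw [pow_succ, mul_apply, pow_succ, Finset.sum_div, Finset.sum_mul]
      refine Finset.sum_congr rfl fun w _ => ?_
      field_simp
    rw [h3] at h1
    have h4 := tendsto_nhds_unique h1 h2
    have h5 : x u₀ * (∑ w, δ w * M w v) = x u₀ * (θ * δ v) := by
      rw [show x u₀ * (θ * δ v) = x u₀ * δ v * θ by ring, h4, Finset.mul_sum]
      exact Finset.sum_congr rfl fun w _ => by ring
    simpa [vecMul, dotProduct] using mul_left_cancel₀ hu₀.ne' h5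
  have hpow := vecMul_pow_of_eigenvector heig'
  -- If `δ u₀` vanished, so would `δ` on the whole support of `x`, by `hpos`. But passing to the
  -- limit in `M ^ k *ᵥ x = θ ^ k • x` at `u₀` writes `x u₀ > 0` as a sum of terms with factors `δ w
  -- * x w`.
  have hsome : 0 < δ u₀ := by
    by_contra hcon
    have h0 : δ u₀ = 0 := le_antisymm (not_lt.1 hcon) (hnonneg u₀)
    have hlim := hδ u₀
    have h1 : ∀ w, 0 < x w → δ w = 0 := by
      intro w hw
      obtain ⟨K, hK⟩ := hpos u₀
      have h2 := congrFun (hpow K) u₀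
      simp only [vecMul, dotProduct, Pi.smul_apply, smul_eq_mul, h0, mul_zero] at h2
      have h3 := (Finset.sum_eq_zero_iff_of_nonneg fun w _ =>
        mul_nonneg (hnonneg w) (pow_apply_nonneg hM K w u₀)).1 h2 w (Finset.mem_univ w)
      exact (mul_eq_zero.1 h3).resolve_right (hK w hw).ne'
    have h2 : Tendsto (fun k : ℕ => ∑ w, (M ^ k) u₀ w / θ ^ k * x w) atTop
        (𝓝 (∑ w, x u₀ * δ w * x w)) :=
      tendsto_finsetSum _ fun w _ => (hδ w u₀).mul_const _
    have h3 : (fun k : ℕ => ∑ w, (M ^ k) u₀ w / θ ^ k * x w) = fun _ => x u₀ := by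
      ext k
      have h4 := congrFun (pow_mulVec_of_eigenvector heig k) u₀
      simp only [mulVec, dotProduct, Pi.smul_apply, smul_eq_mul] at h4
      rw [eq_comm, ← mul_div_cancel_left₀ (x u₀) (pow_pos hθ k).ne', ← h4, Finset.sum_div]
      exact Finset.sum_congr rfl fun w _ => by ring
    rw [h3] at h2
    have h5 : x u₀ = ∑ w, x u₀ * δ w * x w := tendsto_nhds_unique tendsto_const_nhds h2
    rw [Finset.sum_eq_zero] at h5
    · exact hu₀.ne' h5
    · intro w _
      rcases (hx w).eq_or_lt with h | h
      · rw [← h, mul_zero]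
      · rw [h1 w h, mul_zero, zero_mul]
  refine ⟨δ, fun v => ?_, heig', fun u v => hδ v u⟩
  obtain ⟨K, hK⟩ := hpos v
  have h1 := congrFun (hpow K) v
  simp only [vecMul, dotProduct, Pi.smul_apply, smul_eq_mul] at h1
  have h2 : 0 < ∑ w, δ w * (M ^ K) w v :=
    Finset.sum_pos' (fun w _ => mul_nonneg (hnonneg w) (pow_apply_nonneg hM K w v))
      ⟨u₀, Finset.mem_univ _, mul_pos hsome (hK u₀ hu₀)⟩
  rw [h1] at h2
  exact pos_of_mul_pos_right h2 (pow_pos hθ K).le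

/-- A primitive matrix has a positive eigenvector (Perron). -/
theorem exists_pos_eigenvector [Nonempty ι] {M : Matrix ι ι ℝ} (hM : ∀ u v, 0 ≤ M u v)
    {K : ℕ} (hK : 1 ≤ K) (hpos : ∀ u v, 0 < (M ^ K) u v) :
    ∃ t : ℝ, 0 < t ∧ ∃ x : ι → ℝ, (∀ u, 0 < x u) ∧ M *ᵥ x = t • x := by
  classical
  -- Collatz–Wielandt: maximise `t` subject to `t x ≤ M x` on the simplex. The upper bound on `t`
  -- gives compactness and follows from feasibility anyway (`hT`).
  set Z : Set (ℝ × (ι → ℝ)) := (Set.Icc 0 (∑ u, ∑ w, M u w) ×ˢ stdSimplex ℝ ι) ∩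
    {p | ∀ u, p.1 * p.2 u ≤ (M *ᵥ p.2) u} with hZ
  have hcompact : IsCompact Z := by
    refine (isCompact_Icc.prod (isCompact_stdSimplex ℝ ι)).inter_right ?_
    rw [Set.ofPred_forall]
    refine isClosed_iInter fun u => isClosed_le (by fun_prop) ?_
    simp only [mulVec, dotProduct]
    fun_prop
  have hTnn : 0 ≤ ∑ u, ∑ w, M u w := Finset.sum_nonneg fun u _ => Finset.sum_nonneg fun w _ => hM u w
  have hnonempty : Z.Nonempty := by
    obtain ⟨u⟩ := ‹Nonempty ι›
    refine ⟨(0, Pi.single u 1), ⟨⟨⟨le_rfl, hTnn⟩, single_mem_stdSimplex ℝ u⟩, fun w => ?_⟩⟩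
    simp only [zero_mul, mulVec_single_one]
    exact hM w u
  obtain ⟨⟨t, x⟩, ⟨⟨⟨ht0, htT⟩, hxs⟩, hfeas⟩, hmax⟩ :=
    hcompact.exists_isMaxOn hnonempty continuous_fst.continuousOn
  have hxnn := hxs.1
  have hx0 : x ≠ 0 := by
    rintro rfl
    simpa using hxs.2
  have hzpos := fun u => mulVec_pos hpos hxnn hx0 u
  -- `M ^ K` turns a nonzero defect `M x - t x ≥ 0` into a strictly positive one, so `M ^ K x`,
  -- normalised, is feasible for some `t + ε`, against maximality.
  have heig : M *ᵥ x = t • x := by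
    by_contra hne
    have hy : ∀ u, 0 ≤ (M *ᵥ x - t • x) u := fun u => by simpa using hfeas u
    have hy' := fun u => mulVec_pos hpos hy (sub_ne_zero.2 hne) u
    set z := M ^ K *ᵥ x with hz
    obtain ⟨u₁, hu₁⟩ := Finite.exists_min fun u => (M ^ K *ᵥ (M *ᵥ x - t • x)) u / z u
    set ε := (M ^ K *ᵥ (M *ᵥ x - t • x)) u₁ / z u₁ with hε
    have hεpos : 0 < ε := div_pos (hy' u₁) (hzpos u₁)
    have hMz : ∀ u, (t + ε) * z u ≤ (M *ᵥ z) u := by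
      intro u
      have h1 := hu₁ u
      rw [le_div_iff₀ (hzpos u), mulVec_sub, mulVec_smul, mulVec_mulVec, ← pow_succ, pow_succ',
        ← mulVec_mulVec] at h1
      simp only [Pi.sub_apply, Pi.smul_apply, smul_eq_mul] at h1
      linarith
    set s := ∑ u, z u with hs
    have hspos : 0 < s := Finset.sum_pos (fun u _ => hzpos u) Finset.univ_nonempty
    have hmem : (s⁻¹ • z) ∈ stdSimplex ℝ ι :=
      ⟨fun u => mul_nonneg (inv_nonneg.2 hspos.le) (hzpos u).le, by
        simp only [Pi.smul_apply, smul_eq_mul, ← Finset.mul_sum]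
        exact inv_mul_cancel₀ hspos.ne'⟩
    have hfeas' : ∀ u, (t + ε) * (s⁻¹ • z) u ≤ (M *ᵥ (s⁻¹ • z)) u := by
      intro u
      rw [mulVec_smul]
      simp only [Pi.smul_apply, smul_eq_mul]
      nlinarith [mul_le_mul_of_nonneg_left (hMz u) (inv_nonneg.2 hspos.le)]
    have hle1 : ∀ u, (s⁻¹ • z) u ≤ 1 := fun u =>
      hmem.2 ▸ Finset.single_le_sum (fun v _ => hmem.1 v) (Finset.mem_univ u)
    have hT : t + ε ≤ ∑ u, ∑ w, M u w := by
      calc t + ε = ∑ u, (t + ε) * (s⁻¹ • z) u := by rw [← Finset.mul_sum, hmem.2, mul_one]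
        _ ≤ ∑ u, (M *ᵥ (s⁻¹ • z)) u := Finset.sum_le_sum fun u _ => hfeas' u
        _ ≤ _ := Finset.sum_le_sum fun u _ => Finset.sum_le_sum fun w _ =>
          mul_le_of_le_one_right (hM u w) (hle1 w)
    have := hmax (show (t + ε, s⁻¹ • z) ∈ Z from ⟨⟨⟨by linarith, hT⟩, hmem⟩, hfeas'⟩)
    simp only [Set.mem_ofPred_eq] at this
    linarith
  have hpow : ∀ u, 0 < t ^ K * x u := fun u => by
    have := hzpos u
    rwa [pow_mulVec_of_eigenvector heig K] at this
  have hxpos : ∀ u, 0 < x u := fun u => pos_of_mul_pos_right (hpow u) (pow_nonneg ht0 K)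
  obtain ⟨u⟩ := ‹Nonempty ι›
  refine ⟨t, ht0.lt_of_ne' ?_, x, hxpos, heig⟩
  rintro rfl
  have := hpow u
  rw [zero_pow (by omega), zero_mul] at this
  exact this.false

/-- The eigenvalue of a positive eigenvector of a primitive matrix is dominant (Frobenius). -/
theorem isDominantEigenvalue_of_pos_eigenvector [Nonempty ι] {M : Matrix ι ι ℝ}
    (hM : ∀ u v, 0 ≤ M u v) {K : ℕ} (hpos : ∀ u v, 0 < (M ^ K) u v) {t : ℝ} (ht : 0 < t)
    {x : ι → ℝ} (hx : ∀ u, 0 < x u) (heig : M *ᵥ x = t • x) : IsDominantEigenvalue M t := by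
  obtain ⟨u₀⟩ := ‹Nonempty ι›
  obtain ⟨δ, -, -, hδ⟩ := exists_left_eigenvector_tendsto ht hM (fun u => (hx u).le) ⟨u₀, hx u₀⟩ heig
    (fun v => ⟨K, fun u _ => hpos u v⟩) (fun u v => by
      refine ⟨x u / x v, fun k => ?_⟩
      have h1 := congrFun (pow_mulVec_of_eigenvector heig k) u
      have h2 : (M ^ k) u v * x v ≤ ((M ^ k) *ᵥ x) u :=
        Finset.single_le_sum (f := fun w => (M ^ k) u w * x w)
          (fun w _ => mul_nonneg (pow_apply_nonneg hM k u w) (hx w).le) (Finset.mem_univ v)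
      rw [h1] at h2
      rw [div_mul_eq_mul_div, le_div_iff₀ (hx v), mul_comm (x u)]
      exact h2)
    (fun u _ hu => absurd hu (hx u).ne')
  set N := M.map (fun r : ℝ => (r : ℂ)) with hN
  have hNpow : ∀ (k : ℕ) u v, (N ^ k) u v = (((M ^ k) u v : ℝ) : ℂ) := by
    intro k u v
    have : N ^ k = (M ^ k).map Complex.ofRealHom := (Matrix.map_pow M Complex.ofRealHom k).symm
    rw [this]; rfl
  have hspec : ∀ η : ℂ, η ∈ spectrum ℂ N ↔ ∃ z : ι → ℂ, N *ᵥ z = η • z ∧ z ≠ 0 := by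
    intro η
    rw [← Matrix.spectrum_toLin', ← Module.End.hasEigenvalue_iff_mem_spectrum]
    constructor
    · intro h
      obtain ⟨z, hz⟩ := h.exists_hasEigenvector
      exact ⟨z, by simpa using hz.apply_eq_smul, hz.2⟩
    · rintro ⟨z, hz, hz0⟩
      exact Module.End.hasEigenvalue_of_hasEigenvector
        (x := z) ⟨Module.End.mem_eigenspace_iff.2 (by simpa using hz), hz0⟩
  have htC : (t : ℂ) ≠ 0 := by exact_mod_cast ht.ne'
  refine ⟨(hspec _).2 ⟨fun u => (x u : ℂ), ?_, fun h => ?_⟩, fun η hη hne => ?_⟩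
  · ext u
    have := congrFun heig u
    simp only [mulVec, dotProduct, Pi.smul_apply, smul_eq_mul, hN, map_apply] at this ⊢
    exact_mod_cast this
  · have := congrFun h u₀
    simp only [Pi.zero_apply, Complex.ofReal_eq_zero] at this
    exact (hx u₀).ne' this
  -- Convergence of `M ^ k / t ^ k` forces `(η / t) ^ k * z u` to have a limit, which multiplication
  -- by `η / t ≠ 1` fixes. So the limit is 0 and `η / t` has modulus below 1.
  · obtain ⟨z, hz, hz0⟩ := (hspec η).1 hη
    obtain ⟨u, hu⟩ := Function.ne_iff.1 hz0
    have hlim : Tendsto (fun k : ℕ => ∑ v, (((M ^ k) u v / t ^ k : ℝ) : ℂ) * z v) atTop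
        (𝓝 (∑ v, ((x u * δ v : ℝ) : ℂ) * z v)) :=
      tendsto_finsetSum _ fun v _ =>
        ((Complex.continuous_ofReal.tendsto _).comp (hδ u v)).mul_const _
    have heq : (fun k : ℕ => ∑ v, (((M ^ k) u v / t ^ k : ℝ) : ℂ) * z v) =
        fun k : ℕ => (η / t) ^ k * z u := by
      ext k
      have h1 := congrFun (pow_mulVec_of_eigenvector hz k) u
      simp only [mulVec, dotProduct, Pi.smul_apply, smul_eq_mul, hNpow] at h1
      rw [div_pow, div_mul_eq_mul_div, ← h1, Finset.sum_div]
      refine Finset.sum_congr rfl fun v _ => ?_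
      push_cast
      ring
    rw [heq] at hlim
    set L := ∑ v, ((x u * δ v : ℝ) : ℂ) * z v
    have hlim' : Tendsto (fun k : ℕ => (η / t) * ((η / t) ^ k * z u)) atTop (𝓝 L) := by
      have := (tendsto_add_atTop_iff_nat 1).2 hlim
      refine this.congr fun k => ?_
      rw [pow_succ]; ring
    have hL : η / t * L = L := tendsto_nhds_unique (hlim.const_mul (η / t)) hlim'
    have hw : η / t ≠ 1 := fun h => hne ((div_eq_one_iff_eq htC).1 h)
    have hL0 : L = 0 := by
      by_contra h
      exact hw (mul_right_cancel₀ h (by rw [hL, one_mul]))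
    rw [hL0] at hlim
    have h2 : Tendsto (fun k : ℕ => (η / t) ^ k) atTop (𝓝 0) := by
      have := hlim.div_const (z u)
      rw [zero_div] at this
      refine this.congr fun k => ?_
      rw [mul_div_assoc, div_self hu, mul_one]
    have h3 : ‖η / t‖ < 1 := tendsto_pow_atTop_nhds_zero_iff_norm_lt_one.1 h2
    rwa [norm_div, Complex.norm_real, Real.norm_of_nonneg ht.le, div_lt_one ht] at h3

theorem IsDominantEigenvalue.unique {M : Matrix ι ι ℝ} {s t : ℝ} (hs : IsDominantEigenvalue M s)
    (ht : IsDominantEigenvalue M t) : s = t := by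
  by_contra hne
  have h1 := hs.2 t ht.1 (by exact_mod_cast fun h : t = s => hne h.symm)
  have h2 := ht.2 s hs.1 (by exact_mod_cast hne)
  rw [Complex.norm_real] at h1 h2
  linarith [le_abs_self s, le_abs_self t, Real.norm_eq_abs s, Real.norm_eq_abs t]

theorem dominantEigenvalue_eq {M : Matrix ι ι ℝ} {t : ℝ} (ht : IsDominantEigenvalue M t) :
    dominantEigenvalue M = t := by
  have h : ∃ μ, IsDominantEigenvalue M μ := ⟨t, ht⟩
  rw [dominantEigenvalue, dif_pos h]
  exact h.choose_spec.unique ht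

/-- The dominant eigenvalue of a primitive matrix has a positive eigenvector. -/
theorem exists_pos_eigenvector_dominantEigenvalue [Nonempty ι] {M : Matrix ι ι ℝ}
    (hM : ∀ u v, 0 ≤ M u v) {K : ℕ} (hK : 1 ≤ K) (hpos : ∀ u v, 0 < (M ^ K) u v) :
    0 < dominantEigenvalue M ∧
      ∃ x : ι → ℝ, (∀ u, 0 < x u) ∧ M *ᵥ x = dominantEigenvalue M • x := by
  obtain ⟨t, ht, x, hx, heig⟩ := exists_pos_eigenvector hM hK hpos
  rw [dominantEigenvalue_eq (isDominantEigenvalue_of_pos_eigenvector hM hpos ht hx heig)]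
  exact ⟨ht, x, hx, heig⟩

end LinearAlgebra

end PrimitiveComponents

namespace PrimitiveComponents

/-! ### Counting occurrences by starting position -/

section Occurrences

variable {A : Type*}

theorem prefix_congr_of_take {v l l' : List A} (h : l.take v.length = l'.take v.length) :
    v <+: l ↔ v <+: l' := by
  have := List.prefix_take_iff (xs := v) (ys := l) (i := v.length)
  have h2 := List.prefix_take_iff (xs := v) (ys := l') (i := v.length)
  rw [h] at this
  simp only [le_refl, and_true] at this h2
  exact this.symm.trans h2

variable [DecidableEq A]

/-- The number of occurrences of `v` in `w ++ t` that start in `w`. -/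
def occWith (v : List A) : List A → List A → ℕ
  | [], _ => 0
  | a :: w, t => (if v <+: a :: (w ++ t) then 1 else 0) + occWith v w t

theorem occ_eq_occWith (v w : List A) : occ v w = occWith v w [] := by
  induction w with
  | nil => simp [occ, occWith]
  | cons a w ih =>
    rw [occWith, ← ih, occ, occ, Finset.card_filter, Finset.card_filter, List.length_cons,
      Finset.sum_range_succ', add_comm]
    simp

theorem occWith_append (v w₁ w₂ t : List A) :
    occWith v (w₁ ++ w₂) t = occWith v w₁ (w₂ ++ t) + occWith v w₂ t := by
  induction w₁ with
  | nil => simp [occWith]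
  | cons a w ih => simp [occWith, ih, add_assoc]

theorem occWith_le_length (v w t : List A) : occWith v w t ≤ w.length := by
  induction w with
  | nil => simp [occWith]
  | cons a w ih =>
    rw [occWith, List.length_cons]
    split_ifs <;> omega

/-- An occurrence that starts in `w` reaches at most `v.length - 1` letters into the tail. -/
theorem occWith_congr {v t t' : List A} (w : List A)
    (h : t.take (v.length - 1) = t'.take (v.length - 1)) : occWith v w t = occWith v w t' := by
  induction w with
  | nil => rfl
  | cons a w ih =>
    have : v <+: a :: (w ++ t) ↔ v <+: a :: (w ++ t') := by
      apply prefix_congr_of_take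
      rcases hv : v.length with _ | p
      · simp
      · rw [hv, Nat.add_sub_cancel] at h
        rw [List.take_succ_cons, List.take_succ_cons, List.take_append, List.take_append]
        have h2 := congrArg (List.take (p - w.length)) h
        rw [List.take_take, List.take_take, min_eq_left (Nat.sub_le _ _)] at h2
        rw [h2]
    simp only [occWith, ih, this]

theorem occWith_nil_le (v w t : List A) : occWith v w [] ≤ occWith v w t := by
  induction w with
  | nil => simp [occWith]
  | cons a w ih =>
    have : v <+: a :: (w ++ []) → v <+: a :: (w ++ t) := fun h => by
      rw [List.append_nil] at h
      exact h.trans (List.prefix_append (a :: w) t)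
    rw [occWith, occWith]
    split_ifs with h1 h2
    · omega
    · exact absurd (this h1) h2
    · omega
    · omega

/-- Only the last `v.length - 1` starting positions in `w` can read into the tail. -/
theorem occWith_le_add (v w t : List A) : occWith v w t ≤ occWith v w [] + (v.length - 1) := by
  induction w with
  | nil => simp [occWith]
  | cons a w ih =>
    by_cases hv : v.length ≤ (a :: w).length
    · have : v <+: a :: (w ++ t) ↔ v <+: a :: (w ++ []) := by
        rw [List.append_nil]
        apply prefix_congr_of_take
        rw [← List.cons_append, List.take_append_of_le_length hv]
      simp only [occWith, this]
      omega
    · have := occWith_le_length v (a :: w) t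
      omega

theorem infix_of_occWith_pos {v w t : List A} (h : 0 < occWith v w t) : v <:+: w ++ t := by
  induction w with
  | nil => simp [occWith] at h
  | cons a w ih =>
    rw [occWith] at h
    split_ifs at h with h1
    · exact h1.isInfix
    · exact (ih (by omega)).trans (List.suffix_cons a (w ++ t)).isInfix

theorem occWith_pos_of_infix {v w : List A} (hv : v ≠ []) (h : v <:+: w) (t : List A) :
    0 < occWith v w t := by
  refine lt_of_lt_of_le ?_ (occWith_nil_le v w t)
  obtain ⟨s, r, rfl⟩ := h
  rw [List.append_assoc, occWith_append, occWith_append]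
  obtain ⟨a, v', rfl⟩ := List.exists_cons_of_ne_nil hv
  have : (a :: v') <+: a :: (v' ++ (r ++ [])) := List.prefix_append (a :: v') _
  have h1 : occWith (a :: v') (a :: v') (r ++ []) = 1 + occWith (a :: v') v' (r ++ []) := by
    rw [occWith, if_pos this]
  omega

theorem occWith_singleton (b : A) (w t : List A) : occWith [b] w t = w.count b := by
  induction w with
  | nil => simp [occWith]
  | cons a w ih =>
    rw [occWith, ih, List.count_cons, add_comm]
    simp only [List.cons_prefix_cons, List.nil_prefix, and_true, beq_iff_eq, eq_comm (a := b)]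

/-- If `G` is the set of those words of length `m` with first letter satisfying `p` that can occur
in `w ++ t`, then the occurrences of the words of `G` are as many as those of the letters. -/
theorem sum_occWith {m : ℕ} (hm : 1 ≤ m) (p : A → Prop) [DecidablePred p] (G : Finset (List A))
    (hlen : ∀ u ∈ G, u.length = m) (hp : ∀ u ∈ G, ∃ a r, u = a :: r ∧ p a)
    (w t : List A) (ht : m ≤ t.length + 1)
    (hmem : ∀ a r, (a :: r) <:+: w ++ t → (a :: r).length = m → p a → a :: r ∈ G) :
    ∑ u ∈ G, occWith u w t = w.countP (fun a => p a) := by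
  obtain ⟨m, rfl⟩ : ∃ q, m = q + 1 := ⟨m - 1, by omega⟩
  induction w with
  | nil => simp [occWith]
  | cons a w ih =>
    simp only [occWith, Finset.sum_add_distrib]
    rw [ih fun b r h => hmem b r (h.trans (List.suffix_cons a (w ++ t)).isInfix),
      List.countP_cons, add_comm]
    congr 1
    -- Only one word of length `m` can be read at a given position, so the sum over `G` has at most
    -- one nonzero term there; `ht` guarantees that the window is complete.
    have hchar : ∀ u ∈ G, u <+: a :: (w ++ t) ↔ a :: (w ++ t).take m = u := by
      intro u hu
      rw [List.prefix_iff_eq_take, hlen u hu, List.take_succ_cons, eq_comm]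
    rw [Finset.sum_congr rfl fun u hu => if_congr (hchar u hu) rfl rfl, Finset.sum_ite_eq]
    refine if_congr ⟨fun h => ?_, fun h => ?_⟩ rfl rfl
    · obtain ⟨b, r, h1, hb⟩ := hp _ h
      rw [List.cons.injEq] at h1
      simpa [h1.1] using hb
    · refine hmem a _ ?_ ?_ (by simpa using h)
      · rw [← List.take_succ_cons]
        exact (List.take_prefix _ _).isInfix
      · simp; omega

end Occurrences

/-! ### Iterates of the substitution and powers of incidence matrices -/

section Substitution

variable {A : Type*} (σ : A → List A)

theorem iterate_substWord_append (k : ℕ) (w₁ w₂ : List A) :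
    (substWord σ)^[k] (w₁ ++ w₂) = (substWord σ)^[k] w₁ ++ (substWord σ)^[k] w₂ := by
  induction k generalizing w₁ w₂ with
  | zero => rfl
  | succ k ih =>
    rw [Function.iterate_succ_apply, Function.iterate_succ_apply, Function.iterate_succ_apply,
      ← ih, substWord, List.flatMap_append]
    rfl

theorem iterate_substWord_nil (k : ℕ) : (substWord σ)^[k] [] = [] :=
  Function.iterate_fixed rfl k

theorem iterate_substWord_cons (k : ℕ) (a : A) (w : List A) :
    (substWord σ)^[k] (a :: w) = iter σ k a ++ (substWord σ)^[k] w :=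
  iterate_substWord_append σ k [a] w

theorem iter_zero (a : A) : iter σ 0 a = [a] := rfl

theorem iter_add (k l : ℕ) (a : A) : iter σ (k + l) a = (substWord σ)^[k] (iter σ l a) :=
  Function.iterate_add_apply _ k l [a]

theorem iter_one (a : A) : iter σ 1 a = σ a := by simp [iter, substWord]

theorem iter_succ (k : ℕ) (a : A) : iter σ (k + 1) a = (substWord σ)^[k] (σ a) := by
  rw [iter_add, iter_one]

theorem mem_iterate_substWord {k : ℕ} {w : List A} {b : A} :
    b ∈ (substWord σ)^[k] w ↔ ∃ a ∈ w, b ∈ iter σ k a := by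
  induction w with
  | nil => simp [iterate_substWord_nil]
  | cons a w ih => simp [iterate_substWord_cons, ih]

theorem substWord_infix {u w : List A} (k : ℕ) (h : u <:+: w) :
    (substWord σ)^[k] u <:+: (substWord σ)^[k] w := by
  obtain ⟨s, t, rfl⟩ := h
  exact ⟨(substWord σ)^[k] s, (substWord σ)^[k] t, by simp only [iterate_substWord_append]⟩

variable {σ}

theorem length_le_length_iterate (hne : ∀ a, σ a ≠ []) (k : ℕ) (w : List A) :
    w.length ≤ ((substWord σ)^[k] w).length := by
  induction k generalizing w with
  | zero => rfl
  | succ k ih =>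
    rw [Function.iterate_succ_apply]
    refine le_trans ?_ (ih _)
    induction w with
    | nil => simp
    | cons a w ihw =>
      have := List.length_pos_of_ne_nil (hne a)
      simp only [substWord, List.flatMap_cons, List.length_append, List.length_cons] at ihw ⊢
      omega

variable [DecidableEq A]

theorem occWith_iterate_le {v : List A} {k : ℕ} {g : A → ℝ} {w : List A}
    (h : ∀ c ∈ w, ∀ t, (occWith v (iter σ k c) t : ℝ) ≤ g c) (t : List A) :
    (occWith v ((substWord σ)^[k] w) t : ℝ) ≤ (w.map g).sum := by
  induction w with
  | nil => simp [iterate_substWord_nil, occWith]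
  | cons a w ih =>
    rw [iterate_substWord_cons, occWith_append, List.map_cons, List.sum_cons]
    push_cast
    exact add_le_add (h a (by simp) _) (ih fun c hc => h c (by simp [hc]))

theorem sum_le_occWith_iterate {v : List A} {k : ℕ} {g : A → ℝ} {w : List A}
    (h : ∀ c ∈ w, g c ≤ occWith v (iter σ k c) []) :
    (w.map g).sum ≤ occWith v ((substWord σ)^[k] w) [] := by
  induction w with
  | nil => simp [iterate_substWord_nil, occWith]
  | cons a w ih =>
    rw [iterate_substWord_cons, occWith_append, List.map_cons, List.sum_cons]
    push_cast
    refine add_le_add ((h a (by simp)).trans ?_) (ih fun c hc => h c (by simp [hc]))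
    exact_mod_cast occWith_nil_le _ _ _

variable (σ)

/-- The number of occurrences of `v` in `σ^k(u)` that start in `σ^k(u₁)`. -/
def blockOcc (v : List A) (k : ℕ) : List A → ℕ
  | [] => 0
  | a :: t => occWith v (iter σ k a) ((substWord σ)^[k] t)

variable {σ}

/-- An occurrence starting in the image of a letter looks at most `v.length - 1` letters further. As
images are nonempty, these lie in the images of the next `v.length - 1` letters, so a window of
length `v.length` determines the count. -/
theorem occWith_iterate_eq_sum (hne : ∀ a, σ a ≠ []) {v : List A} (hv : 1 ≤ v.length) (k : ℕ)
    (w t : List A) : occWith v ((substWord σ)^[k] w) ((substWord σ)^[k] t) =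
      ((List.range w.length).map
        fun j => blockOcc σ v k (((w ++ t).drop j).take v.length)).sum := by
  induction w with
  | nil => simp [iterate_substWord_nil, occWith]
  | cons c w ih =>
    rw [iterate_substWord_cons, occWith_append, ih, List.length_cons, List.range_succ_eq_map,
      List.map_cons, List.sum_cons, List.map_map]
    congr 1
    obtain ⟨p, hp⟩ : ∃ p, v.length = p + 1 := ⟨v.length - 1, by omega⟩
    rw [List.drop_zero, hp, List.cons_append, List.take_succ_cons, blockOcc,
      ← iterate_substWord_append]
    apply occWith_congr
    rw [hp, Nat.add_sub_cancel]
    conv_lhs => rw [← List.take_append_drop p (w ++ t), iterate_substWord_append]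
    by_cases h : p ≤ (w ++ t).length
    · rw [List.take_append_of_le_length]
      refine le_trans ?_ (length_le_length_iterate hne k _)
      rw [List.length_take]
      omega
    · rw [List.drop_of_length_le (by omega), iterate_substWord_nil, List.append_nil]

theorem blockOcc_succ (hne : ∀ a, σ a ≠ []) {v : List A} (hv : 1 ≤ v.length) (k : ℕ)
    (u : List A) : blockOcc σ v (k + 1) u =
      ((blockSubst σ v.length u).map (blockOcc σ v k)).sum := by
  cases u with
  | nil => simp [blockOcc, blockSubst]
  | cons a t =>
    rw [blockOcc, iter_succ, Function.iterate_succ_apply, occWith_iterate_eq_sum hne hv, blockSubst,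
      List.map_map]
    simp only [substWord, List.flatMap_cons]
    rfl

theorem blockOcc_zero {u v : List A} (h : u.length = v.length) (hv : 1 ≤ v.length) :
    blockOcc σ v 0 u = if u = v then 1 else 0 := by
  cases u with
  | nil =>
    rw [List.length_nil] at h
    omega
  | cons a t =>
    rw [blockOcc, iter_zero, occWith, occWith, add_zero]
    refine if_congr ⟨fun h' => (h'.eq_of_length h.symm).symm, fun h' => ?_⟩ rfl rfl
    subst h'
    exact List.prefix_rfl

theorem sum_count_mul {B : Type*} [DecidableEq B] (S : Finset B) (f : B → ℝ) (l : List B)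
    (h : ∀ w ∈ l, w ∉ S → f w = 0) : ∑ w : S, (l.count (w : B) : ℝ) * f w = (l.map f).sum := by
  rw [Finset.sum_coe_sort S fun w => (l.count w : ℝ) * f w, Finset.sum_list_map_count]
  simp only [nsmul_eq_mul]
  rw [← Finset.sum_subset (Finset.inter_subset_left (s₁ := S) (s₂ := l.toFinset)),
    ← Finset.sum_subset (Finset.inter_subset_right (s₁ := S) (s₂ := l.toFinset))]
  · intro w hw hw'
    rw [h w (List.mem_toFinset.1 hw) fun hS => hw' (Finset.mem_inter.2 ⟨hS, hw⟩), mul_zero]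
  · intro w hw hw'
    rw [List.count_eq_zero_of_not_mem fun hl =>
      hw' (Finset.mem_inter.2 ⟨hw, List.mem_toFinset.2 hl⟩), Nat.cast_zero, zero_mul]

/-- Induction that splits off the first application of `σ^(m)` through `blockOcc_succ`. By
`hclosed`, words that leave `S` never contribute again, so taking the submatrix before the power
loses nothing. -/
theorem incidence_pow_apply (hne : ∀ a, σ a ≠ []) {m : ℕ} (hm : 1 ≤ m) (S : Finset (List A))
    (hlen : ∀ u ∈ S, u.length = m)
    (hclosed : ∀ u ∈ S, ∀ w ∈ blockSubst σ m u, w ∉ S → ∀ v ∈ S, ∀ k, blockOcc σ v k w = 0)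
    (k : ℕ) (u v : S) :
    (incidence (blockSubst σ m) S ^ k) u v = blockOcc σ (v : List A) k u := by
  have hv := hlen v v.2
  induction k generalizing u with
  | zero =>
    rw [blockOcc_zero (by rw [hv, hlen u u.2]) (hv ▸ hm), pow_zero, Matrix.one_apply]
    simp only [Subtype.ext_iff]
    split_ifs <;> norm_num
  | succ k ih =>
    rw [pow_succ', Matrix.mul_apply, blockOcc_succ hne (hv ▸ hm), hv]
    simp only [ih, incidence]
    rw [sum_count_mul S (fun w => (blockOcc σ (v : List A) k w : ℝ)), Nat.cast_list_sum,
      List.map_map]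
    · rfl
    · intro w hw hwS
      rw [hclosed u u.2 w hw hwS v v.2 k, Nat.cast_zero]

end Substitution

/-! ### Languages of the restrictions -/

section Language

variable {A : Type*} {σ : A → List A}

theorem lang_of_infix {S : Finset A} {u w : List A} (hw : w ∈ lang σ S) (h : u <:+: w) :
    u ∈ lang σ S := by
  obtain ⟨k, hk, a, ha, hwa⟩ := hw
  exact ⟨k, hk, a, ha, h.trans hwa⟩

theorem iterate_mem_lang {S : Finset A} {w : List A} (hw : w ∈ lang σ S) (l : ℕ) :
    (substWord σ)^[l] w ∈ lang σ S := by
  obtain ⟨k, hk, a, ha, hwa⟩ := hw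
  exact ⟨l + k, by omega, a, ha, by rw [iter_add]; exact substWord_infix σ l hwa⟩

theorem mem_langOfLength [Fintype A] {S : Finset A} {m : ℕ} {w : List A} :
    w ∈ langOfLength σ S m ↔ w.length = m ∧ w ∈ lang σ S := by
  simp [langOfLength]

theorem length_of_mem_blockSubst (hne : ∀ a, σ a ≠ []) {m : ℕ} {u w : List A} (hu : u.length = m)
    (hw : w ∈ blockSubst σ m u) : w.length = m := by
  cases u with
  | nil => simp [blockSubst] at hw
  | cons a t =>
    simp only [blockSubst, List.mem_map, List.mem_range] at hw
    obtain ⟨j, hj, rfl⟩ := hw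
    have := length_le_length_iterate hne 1 t
    simp only [Function.iterate_one, substWord] at this
    simp only [substWord, List.flatMap_cons, List.length_take, List.length_drop,
      List.length_append, List.length_cons] at hu ⊢
    omega

theorem mem_lang_of_mem_blockSubst {S : Finset A} {m : ℕ} {u w : List A} (hu : u ∈ lang σ S)
    (hw : w ∈ blockSubst σ m u) : w ∈ lang σ S := by
  refine lang_of_infix (iterate_mem_lang hu 1) ?_
  cases u with
  | nil => simp [blockSubst] at hw
  | cons a t =>
    simp only [blockSubst, List.mem_map] at hw
    obtain ⟨j, -, rfl⟩ := hw
    exact (List.take_prefix _ _).isInfix.trans (List.drop_suffix _ _).isInfix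

theorem mem_langOfLength_of_mem_blockSubst [Fintype A] (hne : ∀ a, σ a ≠ []) {S : Finset A} {m : ℕ}
    {u w : List A} (hu : u ∈ langOfLength σ S m) (hw : w ∈ blockSubst σ m u) :
    w ∈ langOfLength σ S m := by
  rw [mem_langOfLength] at hu ⊢
  exact ⟨length_of_mem_blockSubst hne hu.1 hw, mem_lang_of_mem_blockSubst hu.2 hw⟩

/-- The first letters of the words in `σ^(m)(a t)` spell `σ(a)`. This lifts eigenvectors from
letters to words of length `m`. -/
theorem map_head_blockSubst {m : ℕ} (hm : 1 ≤ m) (a : A) (t : List A) (x : A → ℝ) :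
    (blockSubst σ m (a :: t)).map (fun w => (w.head?.map x).getD 0) = (σ a).map x := by
  rw [blockSubst, List.map_map]
  refine List.ext_getElem (by simp) fun j h1 h2 => ?_
  have hj : j < (σ a).length := by simpa using h2
  obtain ⟨p, rfl⟩ : ∃ p, m = p + 1 := ⟨m - 1, by omega⟩
  simp [substWord, List.head?_take, List.head?_drop, List.getElem?_append_left hj, hj]

variable [DecidableEq A]

theorem blockOcc_eq_zero {S : Finset A} {u v : List A} (hu : u ∈ lang σ S) (hv : v ∉ lang σ S)
    (k : ℕ) : blockOcc σ v k u = 0 := by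
  by_contra h
  cases u with
  | nil => exact h rfl
  | cons a t =>
    have := infix_of_occWith_pos (Nat.pos_of_ne_zero h)
    rw [← iterate_substWord_cons] at this
    exact hv (lang_of_infix (iterate_mem_lang hu k) this)

/-- No occurrence lies inside `σ^k(b)` for `k ≥ 1`, so each one must cross the right end. For `k =
0` the word `b` need not belong to the language, and its length bounds the count instead. -/
theorem occWith_iter_le {S : Finset A} {v : List A} (hv : v ∉ lang σ S) {b : A} (hb : b ∈ S)
    (k : ℕ) (t : List A) : occWith v (iter σ k b) t ≤ v.length + 1 := by
  rcases Nat.eq_zero_or_pos k with rfl | hk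
  · have := occWith_le_length v (iter σ 0 b) t
    simp only [iter_zero, List.length_singleton] at this ⊢
    omega
  · have h0 : occWith v (iter σ k b) [] = 0 := by
      by_contra h
      have := infix_of_occWith_pos (Nat.pos_of_ne_zero h)
      rw [List.append_nil] at this
      exact hv ⟨k, hk, b, hb, this⟩
    have := occWith_le_add v (iter σ k b) t
    omega

end Language

end PrimitiveComponents

namespace PrimitiveComponents

/-! ### Finite bounds and letter counts -/

section Bounds

variable {A : Type*}

theorem exists_pos_forall_le (C : Finset A) (x : A → ℝ) : ∃ B, 0 < B ∧ ∀ a ∈ C, x a ≤ B := by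
  refine ⟨∑ a ∈ C, |x a| + 1, ?_, fun a ha => ?_⟩
  · exact add_pos_of_nonneg_of_pos (Finset.sum_nonneg fun a _ => abs_nonneg _) one_pos
  · have := Finset.single_le_sum (f := fun a => |x a|) (fun a _ => abs_nonneg _) ha
    linarith [le_abs_self (x a)]

theorem exists_pos_le_forall {C : Finset A} {x : A → ℝ} (hx : ∀ a ∈ C, 0 < x a) :
    ∃ ε, 0 < ε ∧ ∀ a ∈ C, ε ≤ x a := by
  obtain ⟨B, hB, h⟩ := exists_pos_forall_le C fun a => (x a)⁻¹
  exact ⟨B⁻¹, inv_pos.2 hB, fun a ha => inv_le_of_inv_le₀ (hx a ha) (h a ha)⟩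

theorem sum_map_substWord (σ : A → List A) (x : A → ℝ) (w : List A) :
    ((substWord σ w).map x).sum = (w.map fun a => ((σ a).map x).sum).sum := by
  induction w with
  | nil => rfl
  | cons a w ih =>
    simp only [substWord, List.flatMap_cons, List.map_append, List.sum_append, List.map_cons,
      List.sum_cons] at ih ⊢
    rw [ih]

theorem count_iterate_substWord [DecidableEq A] (σ : A → List A) (b : A) (k : ℕ) (w : List A) :
    ((substWord σ)^[k] w).count b = (w.map fun a => (iter σ k a).count b).sum := by
  induction w with
  | nil => simp [iterate_substWord_nil]
  | cons a w ih => simp [iterate_substWord_cons, ih]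

theorem incidence_pow_eq_count [DecidableEq A] {σ : A → List A} {S : Finset A}
    (hS : ∀ a ∈ S, ∀ c ∈ σ a, c ∉ S → ∀ b ∈ S, ∀ k, b ∉ iter σ k c) (k : ℕ) (a b : S) :
    (incidence σ S ^ k) a b = ((iter σ k a).count (b : A) : ℝ) := by
  induction k generalizing a with
  | zero =>
    rw [pow_zero, Matrix.one_apply, iter_zero, List.count_singleton]
    simp only [Subtype.ext_iff, beq_iff_eq]
    split_ifs <;> norm_num
  | succ k ih =>
    rw [pow_succ', Matrix.mul_apply, iter_succ, count_iterate_substWord]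
    simp only [ih, incidence]
    rw [sum_count_mul S (fun c => ((iter σ k c).count (b : A) : ℝ)), Nat.cast_list_sum,
      List.map_map]
    · rfl
    · intro c hc hcS
      rw [List.count_eq_zero_of_not_mem (hS a a.2 c hc hcS b b.2 k), Nat.cast_zero]

end Bounds

/-! ### Primitive components and growth rates of occurrences -/

section Components

variable {A : Type*} [Fintype A] [DecidableEq A] {σ : A → List A} {n : ℕ} {F : ℕ → Finset A}

theorem IsOfPrimitiveComponents.mono (hσ : IsOfPrimitiveComponents σ n F) {j k : ℕ} (hjk : j ≤ k)
    (hk : k ≤ n) : F j ⊆ F k := by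
  induction k, hjk using Nat.le_induction with
  | base => exact subset_rfl
  | succ k _ ih => exact (ih (by omega)).trans (hσ.strict k (by omega)).1

theorem IsOfPrimitiveComponents.mem_of_mem_image (hσ : IsOfPrimitiveComponents σ n F) {j : ℕ}
    (hj : j ≤ n) {a b : A} (ha : a ∈ F j) (hb : b ∈ σ a) : b ∈ F j := by
  rcases Nat.eq_zero_or_pos j with rfl | h
  · simp [hσ.bot] at ha
  · exact hσ.closed j h hj a ha b hb

theorem IsOfPrimitiveComponents.mem_of_mem_iter (hσ : IsOfPrimitiveComponents σ n F) {j : ℕ}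
    (hj : j ≤ n) {a b : A} (ha : a ∈ F j) {k : ℕ} (hb : b ∈ iter σ k a) : b ∈ F j := by
  induction k generalizing a with
  | zero => rw [iter_zero, List.mem_singleton] at hb; rwa [hb]
  | succ k ih =>
    rw [iter_succ, mem_iterate_substWord] at hb
    obtain ⟨c, hc, hb⟩ := hb
    exact ih (hσ.mem_of_mem_image hj ha hc) hb

theorem IsOfPrimitiveComponents.mem_of_mem_lang (hσ : IsOfPrimitiveComponents σ n F) {j : ℕ}
    (hj : j ≤ n) {w : List A} (hw : w ∈ lang σ (F j)) {b : A} (hb : b ∈ w) : b ∈ F j := by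
  obtain ⟨k, -, a, ha, h⟩ := hw
  exact hσ.mem_of_mem_iter hj ha (h.subset hb)

/-- Otherwise `σ(a)` would lie in the closed alphabet `F (j - 1)`, and `a` could not recur in its
own iterates. -/
theorem IsOfPrimitiveComponents.exists_mem_component (hσ : IsOfPrimitiveComponents σ n F) {j : ℕ}
    (hj1 : 1 ≤ j) (hj : j ≤ n) {a : A} (ha : a ∈ F j \ F (j - 1)) :
    ∃ b ∈ σ a, b ∈ F j \ F (j - 1) := by
  by_contra! h
  obtain ⟨K, hK, hreach⟩ := hσ.reach
  have haF := Finset.mem_sdiff.1 ha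
  have h1 := hreach j hj1 hj a ha a haF.1
  obtain ⟨K, rfl⟩ : ∃ p, K = p + 1 := ⟨K - 1, by omega⟩
  rw [iter_succ, mem_iterate_substWord] at h1
  obtain ⟨c, hc, h1⟩ := h1
  have hc1 : c ∈ F (j - 1) := by
    by_contra hcF
    exact h c hc (Finset.mem_sdiff.2 ⟨hσ.mem_of_mem_image hj haF.1 hc, hcF⟩)
  exact haF.2 (hσ.mem_of_mem_iter (by omega) hc1 h1)

theorem IsOfPrimitiveComponents.eventually_mem_iter (hσ : IsOfPrimitiveComponents σ n F) :
    ∃ K, ∀ k ≥ K, ∀ j, 1 ≤ j → j ≤ n → ∀ a ∈ F j \ F (j - 1), ∀ b ∈ F j, b ∈ iter σ k a := by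
  obtain ⟨K, hK, hreach⟩ := hσ.reach
  refine ⟨K, fun k hk j hj1 hj => ?_⟩
  induction k, hk using Nat.le_induction with
  | base => exact hreach j hj1 hj
  | succ k _ ih =>
    intro a ha b hb
    obtain ⟨c, hc, hcF⟩ := hσ.exists_mem_component hj1 hj ha
    rw [iter_succ, mem_iterate_substWord]
    exact ⟨c, hc, ih c hcF b hb⟩

theorem IsOfPrimitiveComponents.eventually_infix_iter (hσ : IsOfPrimitiveComponents σ n F) {j : ℕ}
    (hj1 : 1 ≤ j) (hj : j ≤ n) {v : List A} (hv : v ∈ lang σ (F j)) :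
    ∃ K, ∀ k ≥ K, ∀ a ∈ F j \ F (j - 1), v <:+: iter σ k a := by
  obtain ⟨l, -, c, hc, hvc⟩ := hv
  obtain ⟨K, hK⟩ := hσ.eventually_mem_iter
  refine ⟨l + K, fun k hk a ha => ?_⟩
  obtain ⟨p, rfl⟩ : ∃ p, k = l + p := ⟨k - l, by omega⟩
  rw [iter_add]
  obtain ⟨s, t, hst⟩ := List.append_of_mem (hK p (by omega) j hj1 hj a ha c hc)
  refine hvc.trans (substWord_infix σ l (u := [c]) ⟨s, t, ?_⟩)
  rw [hst, List.append_assoc, List.singleton_append]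

/-- The weights of the letters of the `j`-th component: a Perron eigenvector. -/
theorem IsOfPrimitiveComponents.exists_weight (hσ : IsOfPrimitiveComponents σ n F) {j : ℕ}
    (hj1 : 1 ≤ j) (hj : j ≤ n) :
    0 < theta σ F j ∧ ∃ x : A → ℝ, (∀ a ∈ F j \ F (j - 1), 0 < x a) ∧
      (∀ a ∉ F j \ F (j - 1), x a = 0) ∧ (∀ a, 0 ≤ x a) ∧
      ∀ a ∈ F j, ((σ a).map x).sum = theta σ F j * x a := by
  obtain ⟨K, hK, hreach⟩ := hσ.reach
  set S := F j \ F (j - 1) with hS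
  have hout : ∀ c ∈ F j, c ∉ S → c ∈ F (j - 1) := fun c hc hcS => by
    by_contra h
    exact hcS (Finset.mem_sdiff.2 ⟨hc, h⟩)
  have hne : Nonempty S := by
    have := hσ.strict (j - 1) (by omega)
    rw [Nat.sub_add_cancel hj1] at this
    obtain ⟨a, ha, ha'⟩ := Finset.exists_of_ssubset this
    exact ⟨⟨a, Finset.mem_sdiff.2 ⟨ha, ha'⟩⟩⟩
  -- A letter that leaves the component lands in `F (j - 1)` and never returns, so powers of the
  -- diagonal block count the letters in the iterates.
  have hpow := incidence_pow_eq_count (σ := σ) (S := S) fun a ha c hc hcS b hb k hbk =>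
    (Finset.mem_sdiff.1 hb).2 (hσ.mem_of_mem_iter (by omega)
      (hout c (hσ.mem_of_mem_image hj (Finset.mem_sdiff.1 ha).1 hc) hcS) hbk)
  obtain ⟨hpos, y, hy, heig⟩ := exists_pos_eigenvector_dominantEigenvalue
    (M := incidence σ S) (fun u v => Nat.cast_nonneg _) hK fun u v => by
      rw [hpow, Nat.cast_pos, List.count_pos_iff]
      exact hreach j hj1 hj u u.2 v (Finset.mem_sdiff.1 v.2).1
  refine ⟨hpos, fun a => if h : a ∈ S then y ⟨a, h⟩ else 0, fun a ha => ?_, fun a ha => ?_,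
    fun a => ?_, fun a ha => ?_⟩
  · simpa only [dif_pos ha] using hy ⟨a, ha⟩
  · exact dif_neg ha
  · by_cases ha : a ∈ S
    · simpa only [dif_pos ha] using (hy ⟨a, ha⟩).le
    · simp only [dif_neg ha, le_refl]
  · by_cases haS : a ∈ S
    · rw [← sum_count_mul S _ _ fun w _ hw => dif_neg hw]
      have := congrFun heig ⟨a, haS⟩
      simp only [dif_pos haS]
      refine Eq.trans ?_ this
      exact Finset.sum_congr rfl fun c _ => by rw [dif_pos c.2]; rfl
    · simp only [dif_neg haS, mul_zero]
      refine List.sum_eq_zero fun r hr => ?_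
      obtain ⟨c, hc, rfl⟩ := List.mem_map.1 hr
      refine dif_neg fun hcS => (Finset.mem_sdiff.1 hcS).2 ?_
      exact hσ.mem_of_mem_image (by omega) (hout a ha haS) hc

theorem IsOfPrimitiveComponents.sum_weight_iter (hσ : IsOfPrimitiveComponents σ n F) {j : ℕ}
    (hj : j ≤ n) {x : A → ℝ} {θ : ℝ} (hx : ∀ a ∈ F j, ((σ a).map x).sum = θ * x a) {a : A}
    (ha : a ∈ F j) (k : ℕ) : ((iter σ k a).map x).sum = θ ^ k * x a := by
  induction k with
  | zero => simp [iter_zero]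
  | succ k ih =>
    rw [iter, Function.iterate_succ_apply', sum_map_substWord]
    have : ((substWord σ)^[k] [a]).map (fun a => ((σ a).map x).sum) =
        (iter σ k a).map fun a => θ * x a :=
      List.map_congr_left fun b hb => hx b (hσ.mem_of_mem_iter hj ha hb)
    rw [this, List.sum_map_mul_left, ih, pow_succ']
    ring

/-- Once `v` occurs in every `σ^K(a)`, a lower bound proportional to the Perron weight of `a` gains
a factor `θ_j` at each further step, since occurrences inside the images of distinct letters add up.
-/
theorem IsOfPrimitiveComponents.exists_le_occWith (hσ : IsOfPrimitiveComponents σ n F) {j : ℕ}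
    (hj1 : 1 ≤ j) (hj : j ≤ n) {v : List A} (hv : v ∈ lang σ (F j)) (hv0 : v ≠ []) :
    ∃ c, 0 < c ∧ ∃ K, ∀ k ≥ K, ∀ a ∈ F j \ F (j - 1),
      c * theta σ F j ^ k ≤ occWith v (iter σ k a) [] := by
  obtain ⟨hθ, x, hx, hx0, hxnn, hxeig⟩ := hσ.exists_weight hj1 hj
  obtain ⟨K, hK⟩ := hσ.eventually_infix_iter hj1 hj hv
  obtain ⟨ε, hε, hεx⟩ := exists_pos_le_forall hx
  obtain ⟨B, hB, hxB⟩ := exists_pos_forall_le (F j \ F (j - 1)) x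
  -- The normalisation makes the bound at `k = K` equal to `x a / B`, which is at most 1.
  have hBK : 0 < B * theta σ F j ^ K := mul_pos hB (pow_pos hθ K)
  have key : ∀ k ≥ K, ∀ a ∈ F j \ F (j - 1),
      (B * theta σ F j ^ K)⁻¹ * theta σ F j ^ k * x a ≤ occWith v (iter σ k a) [] := by
    intro k hk
    induction k, hk using Nat.le_induction with
    | base =>
      intro a ha
      have h1 : (1 : ℝ) ≤ occWith v (iter σ K a) [] := by
        exact_mod_cast occWith_pos_of_infix hv0 (hK K le_rfl a ha) []
      refine le_trans ?_ h1
      rw [mul_assoc, inv_mul_le_iff₀ hBK, mul_one, mul_comm B]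
      exact mul_le_mul_of_nonneg_left (hxB a ha) (pow_pos hθ K).le
    | succ k _ ih =>
      intro a ha
      rw [iter_succ]
      refine le_trans (le_of_eq ?_) (sum_le_occWith_iterate
        (g := fun c => (B * theta σ F j ^ K)⁻¹ * theta σ F j ^ k * x c) fun c _ => ?_)
      · rw [List.sum_map_mul_left, hxeig a (Finset.mem_sdiff.1 ha).1]
        ring
      · by_cases hcS : c ∈ F j \ F (j - 1)
        · exact ih c hcS
        · rw [hx0 c hcS, mul_zero]
          exact Nat.cast_nonneg _
  refine ⟨(B * theta σ F j ^ K)⁻¹ * ε, mul_pos (inv_pos.2 hBK) hε, K, fun k hk a ha => ?_⟩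
  refine le_trans ?_ (key k hk a ha)
  have := mul_le_mul_of_nonneg_left (hεx a ha)
    (mul_nonneg (inv_pos.2 hBK).le (pow_pos hθ k).le)
  linarith

/-- As `θ_j > 1`, some `σ^k(a)` contains `m` copies of `a`; its first copy is therefore followed by
at least `m - 1` letters. -/
theorem IsOfPrimitiveComponents.exists_cons_mem (hσ : IsOfPrimitiveComponents σ n F) {j : ℕ}
    (hj1 : 1 ≤ j) (hj : j ≤ n) (hθ : 1 < theta σ F j) {m : ℕ} (hm : 1 ≤ m) {a : A}
    (ha : a ∈ F j \ F (j - 1)) : ∃ t, a :: t ∈ langOfLength σ (F j) m := by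
  obtain ⟨K₀, hK₀, hreach⟩ := hσ.reach
  have haF := (Finset.mem_sdiff.1 ha).1
  have hlang : [a] ∈ lang σ (F j) := by
    obtain ⟨s, t, hst⟩ := List.append_of_mem (hreach j hj1 hj a ha a haF)
    exact ⟨K₀, hK₀, a, haF, s, t, by rw [hst, List.append_assoc, List.singleton_append]⟩
  obtain ⟨c, hc, K, hK⟩ := hσ.exists_le_occWith hj1 hj hlang (by simp)
  obtain ⟨k, hkK, hk1, hkm⟩ : ∃ k, K ≤ k ∧ 1 ≤ k ∧ (m : ℝ) ≤ c * theta σ F j ^ k :=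
    ((eventually_ge_atTop K).and ((eventually_ge_atTop 1).and
      (((tendsto_pow_atTop_atTop_of_one_lt hθ).const_mul_atTop hc).eventually_ge_atTop
        (m : ℝ)))).exists
  have hcount : m ≤ (iter σ k a).count a := by
    have := hkm.trans (hK k hkK a ha)
    rw [occWith_singleton] at this
    exact_mod_cast this
  have hmem : a ∈ iter σ k a := List.count_pos_iff.1 (by omega)
  obtain ⟨s, t, hst, hs⟩ := List.eq_append_cons_of_mem hmem
  rw [hst, List.count_append, List.count_eq_zero_of_not_mem hs, zero_add] at hcount
  have hlen := hcount.trans List.count_le_length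
  rw [List.length_cons] at hlen
  refine ⟨t.take (m - 1), mem_langOfLength.2 ⟨?_, k, hk1, a, haF, ?_⟩⟩
  · rw [List.length_cons, List.length_take]
    omega
  · rw [← List.take_succ_cons, hst]
    exact (List.take_prefix _ _).isInfix.trans (List.suffix_append s (a :: t)).isInfix

/-- Every `σ^K(a)` contains a letter of component `j`, which yields at least `c₁ θ_i^l` occurrences
after `l` further steps. Each block of `K` steps thus raises the coefficient of `θ_i^k` by a fixed
amount, also when `θ_j = θ_i`. -/
theorem IsOfPrimitiveComponents.tendsto_occWith_atTop (hσ : IsOfPrimitiveComponents σ n F)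
    {i j : ℕ} (hj1 : 1 ≤ j) (hji : j < i) (hi : i ≤ n) (hθ : theta σ F i ≤ theta σ F j)
    {v : List A} (hv : v ∈ lang σ (F j)) (hv0 : v ≠ []) {a : A} (ha : a ∈ F i \ F (i - 1)) :
    Tendsto (fun k : ℕ => 1 / theta σ F i ^ k * (occWith v (iter σ k a) [] : ℝ)) atTop atTop := by
  classical
  obtain ⟨hθi, x, hx, hx0, hxnn, hxeig⟩ := hσ.exists_weight (show 1 ≤ i by omega) hi
  obtain ⟨c₁, hc₁, K₁, hK₁⟩ := hσ.exists_le_occWith hj1 (by omega) hv hv0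
  obtain ⟨K, hK⟩ := hσ.eventually_mem_iter
  obtain ⟨b, hb⟩ : ∃ b, b ∈ F j \ F (j - 1) := by
    have := hσ.strict (j - 1) (by omega)
    rw [Nat.sub_add_cancel hj1] at this
    obtain ⟨b, hb, hb'⟩ := Finset.exists_of_ssubset this
    exact ⟨b, Finset.mem_sdiff.2 ⟨hb, hb'⟩⟩
  have hjF : F j ⊆ F (i - 1) := hσ.mono (by omega) (by omega)
  obtain ⟨B, hB, hxB⟩ := exists_pos_forall_le (F i \ F (i - 1)) x
  set θ := theta σ F i with hθdef
  -- Chosen so that `d * θ ^ K * x a ≤ c₁`: one letter of component `j` pays for the passage from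
  -- `t` to `t + 1`.
  set d := c₁ / (θ ^ K * B) with hd
  have hd0 : 0 < d := div_pos hc₁ (mul_pos (pow_pos hθi K) hB)
  have key : ∀ t : ℕ, ∃ k₀, ∀ k ≥ k₀, ∀ a ∈ F i \ F (i - 1),
      t * d * θ ^ k * x a ≤ occWith v (iter σ k a) [] := by
    intro t
    induction t with
    | zero => exact ⟨0, fun k _ a _ => by simp⟩
    | succ t ih =>
      obtain ⟨k₀, hk₀⟩ := ih
      refine ⟨k₀ + K₁ + K, fun k hk a ha => ?_⟩
      obtain ⟨l, rfl⟩ : ∃ l, k = l + K := ⟨k - K, by omega⟩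
      have haF := (Finset.mem_sdiff.1 ha).1
      set y : A → ℝ := fun c => if c ∈ F j \ F (j - 1) then 1 else 0 with hy
      have hynn : ∀ c, 0 ≤ y c := fun c => by simp only [hy]; split_ifs <;> norm_num
      have hysum : 1 ≤ ((iter σ K a).map y).sum := by
        have hbF := hσ.mono (show j ≤ i by omega) hi (Finset.mem_sdiff.1 hb).1
        have hmem := List.mem_map_of_mem (f := y) (hK K le_rfl i (by omega) hi a ha b hbF)
        have hyb : y b = 1 := if_pos hb
        rw [hyb] at hmem
        refine List.single_le_sum (fun r hr => ?_) 1 hmem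
        obtain ⟨c, -, rfl⟩ := List.mem_map.1 hr
        exact hynn c
      rw [iter_add]
      refine le_trans ?_ (sum_le_occWith_iterate
        (g := fun c => t * d * θ ^ l * x c + c₁ * θ ^ l * y c) fun c _ => ?_)
      · rw [List.sum_map_add, List.sum_map_mul_left, List.sum_map_mul_left,
          hσ.sum_weight_iter hi hxeig haF]
        have h1 : d * θ ^ K * x a ≤ c₁ := by
          rw [hd, div_mul_eq_mul_div, div_mul_eq_mul_div,
            div_le_iff₀ (mul_pos (pow_pos hθi K) hB), mul_assoc]
          exact mul_le_mul_of_nonneg_left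
            (mul_le_mul_of_nonneg_left (hxB a ha) (pow_pos hθi K).le) hc₁.le
        have h2 := mul_le_mul_of_nonneg_left h1 (pow_pos hθi l).le
        have h3 := mul_le_mul_of_nonneg_left hysum (mul_pos hc₁ (pow_pos hθi l)).le
        push_cast
        rw [pow_add]
        linarith
      · by_cases hcj : c ∈ F j \ F (j - 1)
        · have hcx : x c = 0 := hx0 c fun h =>
            (Finset.mem_sdiff.1 h).2 (hjF (Finset.mem_sdiff.1 hcj).1)
          have hyc : y c = 1 := if_pos hcj
          rw [hcx, hyc, mul_zero, zero_add, mul_one]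
          refine le_trans ?_ (hK₁ l (by omega) c hcj)
          exact mul_le_mul_of_nonneg_left (pow_le_pow_left₀ hθi.le hθ l) hc₁.le
        · have hyc : y c = 0 := if_neg hcj
          rw [hyc, mul_zero, add_zero]
          by_cases hci : c ∈ F i \ F (i - 1)
          · exact hk₀ l (by omega) c hci
          · rw [hx0 c hci, mul_zero]
            exact Nat.cast_nonneg _
  refine tendsto_atTop.2 fun r => ?_
  have hdx : 0 < d * x a := mul_pos hd0 (hx a ha)
  obtain ⟨t, ht⟩ := exists_nat_ge (r / (d * x a))
  rw [div_le_iff₀ hdx] at ht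
  obtain ⟨k₀, hk₀⟩ := key t
  filter_upwards [eventually_ge_atTop k₀] with k hk
  have := hk₀ k hk a ha
  rw [one_div, inv_mul_eq_div, le_div_iff₀ (pow_pos hθi k)]
  have h2 := mul_le_mul_of_nonneg_right ht (pow_pos hθi k).le
  linarith

/-- Induction on the level. At level `l` the counts are bounded, so rate 1 works because `θ > 1`.
Each new level may take any rate strictly above the previous rate and its own eigenvalue, which
absorbs resonances and still leaves room below `θ`. -/
theorem IsOfPrimitiveComponents.exists_occWith_le_lower (hσ : IsOfPrimitiveComponents σ n F)
    {i l : ℕ} (hi : i ≤ n) {θ : ℝ} (hθ1 : 1 < θ)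
    (hθ : ∀ j, l < j → j < i → theta σ F j < θ) {v : List A} (hv : v ∉ lang σ (F l)) {j : ℕ}
    (hlj : l ≤ j) (hji : j < i) :
    ∃ ρ C : ℝ, 0 < ρ ∧ ρ < θ ∧ 0 ≤ C ∧ ∀ k, ∀ a ∈ F j, ∀ t,
      (occWith v (iter σ k a) t : ℝ) ≤ C * ρ ^ k := by
  induction j, hlj using Nat.le_induction with
  | base =>
    refine ⟨1, v.length + 1, one_pos, hθ1, by positivity, fun k a ha t => ?_⟩
    rw [one_pow, mul_one]
    exact_mod_cast occWith_iter_le hv ha k t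
  | succ j hlj ih =>
    obtain ⟨ρ₀, C, hρ₀, hρ₀θ, hC, hbound⟩ := ih (by omega)
    obtain ⟨hθj, x, hx, hx0, hxnn, hxeig⟩ := hσ.exists_weight (show 1 ≤ j + 1 by omega) (by omega)
    rw [Nat.add_sub_cancel] at hx hx0
    obtain ⟨ρ, hρ, hρθ⟩ := exists_between (max_lt hρ₀θ (hθ (j + 1) (by omega) hji))
    obtain ⟨h1, h2⟩ := max_lt_iff.1 hρ
    have hρ0 : 0 < ρ := hρ₀.trans h1
    obtain ⟨B, hB, hxB⟩ := exists_pos_forall_le (F (j + 1) \ F j) x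
    -- `D₁` settles `k = 0`; `D₂` lets the gap between `ρ` and the eigenvalue of this level absorb
    -- the letters of `F j` in `σ a`.
    obtain ⟨D₁, hD₁, hD₁x⟩ := exists_pos_forall_le (F (j + 1) \ F j) fun a => 1 / x a
    obtain ⟨D₂, hD₂, hD₂x⟩ := exists_pos_forall_le (F (j + 1) \ F j)
      fun a => C * (σ a).length / ((ρ - theta σ F (j + 1)) * x a)
    have hb0 : ∀ k, ∀ a ∈ F j, ∀ t, (occWith v (iter σ k a) t : ℝ) ≤ C * ρ ^ k :=
      fun k a ha t => (hbound k a ha t).trans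
        (mul_le_mul_of_nonneg_left (pow_le_pow_left₀ hρ₀.le h1.le k) hC)
    have key : ∀ k, ∀ a ∈ F (j + 1) \ F j, ∀ t,
        (occWith v (iter σ k a) t : ℝ) ≤ (D₁ + D₂) * ρ ^ k * x a := by
      intro k
      induction k with
      | zero =>
        intro a ha t
        have h3 : (occWith v (iter σ 0 a) t : ℝ) ≤ 1 := by
          exact_mod_cast occWith_le_length v (iter σ 0 a) t
        have h4 := hD₁x a ha
        rw [div_le_iff₀ (hx a ha)] at h4
        rw [pow_zero, mul_one]
        nlinarith [mul_pos hD₂ (hx a ha)]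
      | succ k ihk =>
        intro a ha t
        have haF := (Finset.mem_sdiff.1 ha).1
        rw [iter_succ]
        refine (occWith_iterate_le
          (g := fun c => (D₁ + D₂) * ρ ^ k * x c + C * ρ ^ k) (fun c hc t => ?_) t).trans ?_
        · by_cases hcj : c ∈ F j
          · have := hb0 k c hcj t
            have h3 : 0 ≤ (D₁ + D₂) * ρ ^ k * x c := mul_nonneg (by positivity) (hxnn c)
            linarith
          · have := ihk c (Finset.mem_sdiff.2 ⟨hσ.mem_of_mem_image (by omega) haF hc, hcj⟩) t
            have h3 : 0 ≤ C * ρ ^ k := by positivity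
            linarith
        · rw [List.sum_map_add, List.sum_map_mul_left, hxeig a haF, List.map_const', List.sum_replicate,
            nsmul_eq_mul]
          have h4 := hD₂x a ha
          rw [div_le_iff₀ (mul_pos (sub_pos.2 h2) (hx a ha))] at h4
          have h5 : C * (σ a).length ≤ (D₁ + D₂) * ((ρ - theta σ F (j + 1)) * x a) := by
            nlinarith [mul_pos hD₁ (mul_pos (sub_pos.2 h2) (hx a ha))]
          have h6 := mul_le_mul_of_nonneg_right h5 (pow_pos hρ0 k).le
          rw [pow_succ]
          linarith
    refine ⟨ρ, (D₁ + D₂) * B + C, hρ0, hρθ, by positivity, fun k a ha t => ?_⟩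
    have hρk := pow_pos hρ0 k
    by_cases haj : a ∈ F j
    · have := hb0 k a haj t
      have h3 : 0 ≤ (D₁ + D₂) * B * ρ ^ k := by positivity
      linarith
    · have haS := Finset.mem_sdiff.2 ⟨ha, haj⟩
      have h3 := key k a haS t
      have h4 := mul_le_mul_of_nonneg_left (hxB a haS)
        (show 0 ≤ (D₁ + D₂) * ρ ^ k by positivity)
      have h5 : 0 ≤ C * ρ ^ k := by positivity
      linarith

/-- At level `i` the exact rate `θ_i` is needed, so no gap can be spent. The induction is instead
strengthened by subtracting `E * ρ ^ k`, with `E` so large that this term absorbs the contribution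
of the lower letters. -/
theorem IsOfPrimitiveComponents.exists_occWith_le (hσ : IsOfPrimitiveComponents σ n F)
    {i l : ℕ} (hli : l < i) (hi : i ≤ n) (hθ1 : 1 < theta σ F i)
    (hθ : ∀ j, l < j → j < i → theta σ F j < theta σ F i) {v : List A} (hv : v ∉ lang σ (F l)) :
    ∃ C : ℝ, ∀ k, ∀ a ∈ F i, ∀ t, (occWith v (iter σ k a) t : ℝ) ≤ C * theta σ F i ^ k := by
  obtain ⟨ρ, C, hρ, hρθ, hC, hbound⟩ := hσ.exists_occWith_le_lower hi hθ1 hθ hv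
    (show l ≤ i - 1 by omega) (by omega)
  obtain ⟨hθi, x, hx, hx0, hxnn, hxeig⟩ := hσ.exists_weight (show 1 ≤ i by omega) hi
  obtain ⟨B, hB, hxB⟩ := exists_pos_forall_le (F i \ F (i - 1)) x
  obtain ⟨D, hD, hDx⟩ := exists_pos_forall_le (F i \ F (i - 1)) fun a => 1 / x a
  obtain ⟨E, hE, hEx⟩ := exists_pos_forall_le (F i \ F (i - 1))
    fun a => C * (σ a).length / ((theta σ F i - ρ) * x a)
  set θ := theta σ F i with hθdef
  have key : ∀ k, ∀ a ∈ F i \ F (i - 1), ∀ t,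
      (occWith v (iter σ k a) t : ℝ) ≤ ((D + E) * θ ^ k - E * ρ ^ k) * x a := by
    intro k
    induction k with
    | zero =>
      intro a ha t
      have h3 : (occWith v (iter σ 0 a) t : ℝ) ≤ 1 := by
        exact_mod_cast occWith_le_length v (iter σ 0 a) t
      have h4 := hDx a ha
      rw [div_le_iff₀ (hx a ha)] at h4
      rw [pow_zero, pow_zero]
      linarith
    | succ k ihk =>
      intro a ha t
      have haF := (Finset.mem_sdiff.1 ha).1
      have hnn : 0 ≤ (D + E) * θ ^ k - E * ρ ^ k := by
        have h3 := mul_le_mul_of_nonneg_left (pow_le_pow_left₀ hρ.le hρθ.le k) hE.le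
        have h4 := mul_pos hD (pow_pos hθi k)
        linarith
      rw [iter_succ]
      refine (occWith_iterate_le
        (g := fun c => ((D + E) * θ ^ k - E * ρ ^ k) * x c + C * ρ ^ k) (fun c hc t => ?_) t).trans ?_
      · by_cases hcj : c ∈ F (i - 1)
        · have := hbound k c hcj t
          have h3 := mul_nonneg hnn (hxnn c)
          linarith
        · have := ihk c (Finset.mem_sdiff.2 ⟨hσ.mem_of_mem_image hi haF hc, hcj⟩) t
          have h3 : 0 ≤ C * ρ ^ k := by positivity
          linarith
      · rw [List.sum_map_add, List.sum_map_mul_left, hxeig a haF, List.map_const',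
          List.sum_replicate, nsmul_eq_mul]
        have h4 := hEx a ha
        rw [div_le_iff₀ (mul_pos (sub_pos.2 hρθ) (hx a ha))] at h4
        have h6 := mul_le_mul_of_nonneg_right h4 (pow_pos hρ k).le
        rw [pow_succ, pow_succ]
        linarith
  refine ⟨(D + E) * B + C, fun k a ha t => ?_⟩
  have hθk := pow_pos hθi k
  by_cases haj : a ∈ F (i - 1)
  · have h3 := hbound k a haj t
    have h4 : 0 ≤ (D + E) * B * θ ^ k := by positivity
    have h5 := mul_le_mul_of_nonneg_left (pow_le_pow_left₀ hρ.le hρθ.le k) hC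
    linarith
  · have haS := Finset.mem_sdiff.2 ⟨ha, haj⟩
    have h3 := key k a haS t
    have h4 := mul_le_mul_of_nonneg_left (hxB a haS)
      (show 0 ≤ (D + E) * θ ^ k by positivity)
    have h5 : 0 ≤ C * θ ^ k := by positivity
    have h6 : 0 ≤ E * ρ ^ k * x a := mul_nonneg (by positivity) (hxnn a)
    linarith

end Components

end PrimitiveComponents

namespace PrimitiveComponents

/-! ### Limits over a range of levels in which `θ_i` dominates -/

section Asymptotics

variable {A : Type*}

/-- The weight of the first letter of a word. -/
def headWeight (x : A → ℝ) (w : List A) : ℝ := (w.head?.map x).getD 0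

theorem headWeight_cons (x : A → ℝ) (a : A) (t : List A) : headWeight x (a :: t) = x a := rfl

variable [DecidableEq A]

theorem sum_count_eq_countP (C : Finset A) (w : List A) :
    ∑ b ∈ C, w.count b = w.countP (fun a => a ∈ C) := by
  induction w with
  | nil => simp
  | cons a w ih => simp [List.count_cons, List.countP_cons, Finset.sum_add_distrib, ih]

/-- Minimality of `i'` gives the last alternative. If the index set is empty, `i' - 1 = i - 1`, and
`θ_{i-1} < θ_i` would put `i - 1` into that set. -/
theorem iPrime_spec {i : ℕ} (σ : A → List A) (F : ℕ → Finset A) (hi : 1 < i) :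
    iPrime σ F i - 1 < i ∧ (∀ j, iPrime σ F i - 1 < j → j < i → theta σ F j < theta σ F i) ∧
      (iPrime σ F i - 1 = 0 ∨ theta σ F i ≤ theta σ F (iPrime σ F i - 1)) := by
  by_cases hne : (indexSet σ F i).Nonempty
  · have hmem := Nat.sInf_mem hne
    rw [iPrime, if_pos hne]
    obtain ⟨h1, h2, h3⟩ := hmem
    refine ⟨by omega, fun j hj hji => h3 j (by omega) hji, ?_⟩
    by_contra! hcon
    refine Nat.notMem_of_lt_sInf (m := sInf (indexSet σ F i) - 1) (s := indexSet σ F i) (by omega)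
      ⟨by omega, by omega, fun j hj hji => ?_⟩
    rcases hj.eq_or_lt with rfl | hj
    · exact hcon.2
    · exact h3 j (by omega) hji
  · rw [iPrime, if_neg hne]
    refine ⟨by omega, fun j hj hji => by omega, Or.inr ?_⟩
    by_contra! hcon
    refine hne ⟨i - 1, by omega, by omega, fun j hj hji => ?_⟩
    rwa [show j = i - 1 by omega]

theorem theta_le_lam (σ : A → List A) (F : ℕ → Finset A) {j r : ℕ} (hj : 1 ≤ j) (hjr : j ≤ r) :
    theta σ F j ≤ lam σ F r :=
  le_csSup ((Set.finite_Icc 1 r).image _).bddAbove ⟨j, ⟨hj, hjr⟩, rfl⟩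

theorem lam_lt (σ : A → List A) (F : ℕ → Finset A) {r : ℕ} (hr : 1 ≤ r) {θ : ℝ}
    (h : ∀ j, 1 ≤ j → j ≤ r → theta σ F j < θ) : lam σ F r < θ := by
  have hne : (theta σ F '' Set.Icc 1 r).Nonempty := ⟨_, 1, ⟨le_rfl, hr⟩, rfl⟩
  obtain ⟨j, hj, hjr⟩ := hne.csSup_mem ((Set.finite_Icc 1 r).image _)
  rw [lam, ← hjr]
  exact h j hj.1 hj.2

variable [Fintype A] {σ : A → List A} {n : ℕ} {F : ℕ → Finset A} {i l m : ℕ}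

/-- Between the levels `l` and `i` the eigenvalue `θ_i > 1` is strictly dominant. The words
considered are those of `ℒ_m(σ_i) \ ℒ_m(σ_l)`. -/
structure IsDominantRange (σ : A → List A) (n : ℕ) (F : ℕ → Finset A) (i l m : ℕ) : Prop where
  components : IsOfPrimitiveComponents σ n F
  lt : l < i
  le : i ≤ n
  one_lt : 1 < theta σ F i
  theta_lt : ∀ j, l < j → j < i → theta σ F j < theta σ F i
  one_le : 1 ≤ m

namespace IsDominantRange

variable {S : Finset (List A)}

theorem exists_cons_of_mem (h : IsDominantRange σ n F i l m)
    (hS : S = langOfLength σ (F i) m \ langOfLength σ (F l) m) {u : List A} (hu : u ∈ S) :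
    u.length = m ∧ u ∉ lang σ (F l) ∧ ∃ a t, u = a :: t ∧ a ∈ F i := by
  rw [hS, Finset.mem_sdiff, mem_langOfLength, mem_langOfLength] at hu
  obtain ⟨⟨h1, h2⟩, h3⟩ := hu
  refine ⟨h1, fun h4 => h3 ⟨h1, h4⟩, ?_⟩
  cases u with
  | nil =>
    have := h.one_le
    rw [List.length_nil] at h1
    omega
  | cons a t => exact ⟨a, t, rfl, h.components.mem_of_mem_lang h.le h2 (by simp)⟩

theorem cons_mem (h : IsDominantRange σ n F i l m)
    (hS : S = langOfLength σ (F i) m \ langOfLength σ (F l) m) {a : A} {t : List A}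
    (ha : a ∈ F i \ F (i - 1)) (ht : a :: t ∈ langOfLength σ (F i) m) : a :: t ∈ S := by
  rw [hS, Finset.mem_sdiff]
  have hli := h.lt
  have hin := h.le
  refine ⟨ht, fun h1 => (Finset.mem_sdiff.1 ha).2 ?_⟩
  have h2 := h.components.mem_of_mem_lang (j := l) (by omega) (mem_langOfLength.1 h1).2
    (b := a) (by simp)
  exact h.components.mono (by omega) (by omega) h2

/-- Words that leave `S` fall into `ℒ_m(σ_l)`, and their iterates contain no word of `S`. -/
theorem pow_apply (h : IsDominantRange σ n F i l m)
    (hS : S = langOfLength σ (F i) m \ langOfLength σ (F l) m) (k : ℕ) (u v : S) :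
    (incidence (blockSubst σ m) S ^ k) u v = blockOcc σ (v : List A) k u := by
  refine incidence_pow_apply h.components.ne_nil h.one_le S
    (fun u hu => (h.exists_cons_of_mem hS hu).1) (fun u hu w hw hwS v hv k => ?_) k u v
  rw [hS, Finset.mem_sdiff] at hu hwS
  have hwi := mem_langOfLength_of_mem_blockSubst h.components.ne_nil hu.1 hw
  have hwl : w ∈ langOfLength σ (F l) m := by
    by_contra hwl
    exact hwS ⟨hwi, hwl⟩
  exact blockOcc_eq_zero (mem_langOfLength.1 hwl).2 (h.exists_cons_of_mem hS hv).2.1 k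

theorem exists_tendsto (h : IsDominantRange σ n F i l m)
    (hS : S = langOfLength σ (F i) m \ langOfLength σ (F l) m) :
    ∃ x : A → ℝ, (∀ a ∈ F i \ F (i - 1), 0 < x a) ∧ ∃ δ : S → ℝ, (∀ v, 0 < δ v) ∧
      IsLeftEigenvector (incidence (blockSubst σ m) S) (theta σ F i) δ ∧
      ∀ u v : S, Tendsto
        (fun k : ℕ => (incidence (blockSubst σ m) S ^ k) u v / theta σ F i ^ k) atTop
        (𝓝 (headWeight x u * δ v)) := by
  have hσ := h.components
  have hli := h.lt
  have hin := h.le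
  obtain ⟨hθ, x, hx, hx0, hxnn, hxeig⟩ := hσ.exists_weight (show 1 ≤ i by omega) h.le
  obtain ⟨a₀, ha₀⟩ : ∃ a, a ∈ F i \ F (i - 1) := by
    have := hσ.strict (i - 1) (by omega)
    rw [Nat.sub_add_cancel (by omega)] at this
    obtain ⟨b, hb, hb'⟩ := Finset.exists_of_ssubset this
    exact ⟨b, Finset.mem_sdiff.2 ⟨hb, hb'⟩⟩
  obtain ⟨t₀, ht₀⟩ := hσ.exists_cons_mem (by omega) h.le h.one_lt h.one_le ha₀
  have hu₀ := h.cons_mem hS ha₀ ht₀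
  have hpow := h.pow_apply hS
  suffices hδ : ∃ δ : S → ℝ, (∀ v, 0 < δ v) ∧
      Matrix.vecMul δ (incidence (blockSubst σ m) S) = theta σ F i • δ ∧
      ∀ u v : S, Tendsto
        (fun k : ℕ => (incidence (blockSubst σ m) S ^ k) u v / theta σ F i ^ k) atTop
        (𝓝 (headWeight x u * δ v)) by
    obtain ⟨δ, hδ, hδeig, hlim⟩ := hδ
    refine ⟨x, hx, δ, hδ, ⟨fun h0 => ?_, hδeig⟩, hlim⟩
    have := hδ ⟨_, hu₀⟩
    rw [h0] at this
    exact this.false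
  refine exists_left_eigenvector_tendsto
    (M := incidence (blockSubst σ m) S) (x := fun u : S => headWeight x u) hθ
    (fun u v => Nat.cast_nonneg _) ?_ ⟨⟨_, hu₀⟩, hx a₀ ha₀⟩ ?_ ?_ ?_ ?_
  · rintro ⟨u, hu⟩
    obtain ⟨-, -, a, t, rfl, -⟩ := h.exists_cons_of_mem hS hu
    exact hxnn a
  · ext ⟨u, hu⟩
    obtain ⟨-, -, a, t, rfl, ha⟩ := h.exists_cons_of_mem hS hu
    -- A word of `ℒ_m(σ_i)` outside `S` cannot start in component `i`, so it has weight 0 and the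
    -- eigenvector equation survives the restriction to `S`.
    have h1 := sum_count_mul S (headWeight x) (blockSubst σ m (a :: t)) fun w hw hwS => by
      rw [hS, Finset.mem_sdiff] at hu hwS
      have hwi := mem_langOfLength_of_mem_blockSubst hσ.ne_nil hu.1 hw
      cases w with
      | nil => rfl
      | cons b r =>
        refine hx0 b fun hb => hwS ?_
        have := h.cons_mem hS hb hwi
        rwa [hS, Finset.mem_sdiff] at this
    refine h1.trans ?_
    have h2 : (blockSubst σ m (a :: t)).map (headWeight x) = (σ a).map x :=
      map_head_blockSubst h.one_le a t x
    rw [h2]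
    exact hxeig a ha
  · rintro ⟨v, hv⟩
    have hvi := hv
    rw [hS, Finset.mem_sdiff] at hvi
    obtain ⟨K, hK⟩ := hσ.eventually_infix_iter (by omega) h.le (mem_langOfLength.1 hvi.1).2
    refine ⟨K, ?_⟩
    rintro ⟨u, hu⟩ hxu
    obtain ⟨-, -, a, t, rfl, ha⟩ := h.exists_cons_of_mem hS hu
    have haS : a ∈ F i \ F (i - 1) := by
      by_contra haS
      have : headWeight x (a :: t) = 0 := hx0 a haS
      exact hxu.ne' this
    rw [hpow, Nat.cast_pos]
    obtain ⟨-, -, b, r, rfl, -⟩ := h.exists_cons_of_mem hS hv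
    exact occWith_pos_of_infix (by simp) (hK K le_rfl a haS) _
  · rintro ⟨u, hu⟩ ⟨v, hv⟩
    obtain ⟨-, -, a, t, rfl, ha⟩ := h.exists_cons_of_mem hS hu
    obtain ⟨C, hC⟩ := hσ.exists_occWith_le h.lt h.le h.one_lt h.theta_lt
      (h.exists_cons_of_mem hS hv).2.1
    refine ⟨C, fun k => ?_⟩
    rw [hpow]
    exact hC k a ha _
  · rintro ⟨u, hu⟩ ⟨v, hv⟩ hxu
    obtain ⟨-, -, a, t, rfl, ha⟩ := h.exists_cons_of_mem hS hu
    have haS : a ∈ F (i - 1) := by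
      by_contra haS
      exact (hx a (Finset.mem_sdiff.2 ⟨ha, haS⟩)).ne' hxu
    obtain ⟨ρ, C, hρ, hρθ, hC, hbound⟩ := hσ.exists_occWith_le_lower h.le h.one_lt h.theta_lt
      (h.exists_cons_of_mem hS hv).2.1 (show l ≤ i - 1 by omega) (by omega)
    have hlim : Tendsto (fun k : ℕ => C * (ρ / theta σ F i) ^ k) atTop (𝓝 0) := by
      have := (tendsto_pow_atTop_nhds_zero_of_lt_one (div_pos hρ hθ).le
        ((div_lt_one hθ).2 hρθ)).const_mul C
      rwa [mul_zero] at this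
    refine squeeze_zero (fun k => ?_) (fun k => ?_) hlim
    · rw [hpow]
      exact div_nonneg (Nat.cast_nonneg _) (pow_pos hθ k).le
    · rw [hpow, div_pow, ← mul_div_assoc]
      exact div_le_div_of_nonneg_right (hbound k a haS _) (pow_pos hθ k).le

variable {x : A → ℝ} {δ : S → ℝ}

/-- Cutting `σ^k(a t)` down to `σ^k(a)` loses fewer than `m` occurrences, which is negligible
against `θ_i^k`. -/
theorem tendsto_occ (h : IsDominantRange σ n F i l m)
    (hS : S = langOfLength σ (F i) m \ langOfLength σ (F l) m)
    (hlim : ∀ u v : S, Tendsto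
        (fun k : ℕ => (incidence (blockSubst σ m) S ^ k) u v / theta σ F i ^ k) atTop
        (𝓝 (headWeight x u * δ v))) {a : A} (ha : a ∈ F i \ F (i - 1)) (v : S) :
    Tendsto (fun k : ℕ => (occ (v : List A) (iter σ k a) : ℝ) / theta σ F i ^ k) atTop
      (𝓝 (x a * δ v)) := by
  have hli := h.lt
  have hθ : 0 < theta σ F i := one_pos.trans h.one_lt
  obtain ⟨t, ht⟩ := h.components.exists_cons_mem (by omega) h.le h.one_lt h.one_le ha
  have hu := h.cons_mem hS ha ht
  have h1 := hlim ⟨_, hu⟩ v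
  simp only [h.pow_apply hS, headWeight_cons] at h1
  have h2 : Tendsto (fun k : ℕ => (m : ℝ) / theta σ F i ^ k) atTop (𝓝 0) :=
    (tendsto_pow_atTop_atTop_of_one_lt h.one_lt).const_div_atTop _
  have h3 := h1.sub h2
  rw [sub_zero] at h3
  refine tendsto_of_tendsto_of_tendsto_of_le_of_le h3 h1 (fun k => ?_) (fun k => ?_)
  · have hle := occWith_le_add (v : List A) (iter σ k a) ((substWord σ)^[k] t)
    have hvm := (h.exists_cons_of_mem hS v.2).1
    have hle' : (blockOcc σ (v : List A) k (a :: t) : ℝ) ≤ occ (v : List A) (iter σ k a) + m := by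
      rw [occ_eq_occWith]
      have : blockOcc σ (v : List A) k (a :: t) ≤ occWith (v : List A) (iter σ k a) [] + m := by
        rw [blockOcc]
        omega
      exact_mod_cast this
    simp only [← sub_div]
    exact div_le_div_of_nonneg_right (by linarith) (pow_pos hθ k).le
  · refine div_le_div_of_nonneg_right ?_ (pow_pos hθ k).le
    rw [occ_eq_occWith]
    exact Nat.cast_le.2 (occWith_nil_le _ _ _)

/-- Turns word counts into letter counts: `p` is taken to be always true for the length, and
membership in component `i` for the denominator in (iii). -/
theorem tendsto_countP (h : IsDominantRange σ n F i l m)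
    (hS : S = langOfLength σ (F i) m \ langOfLength σ (F l) m)
    (hlim : ∀ u v : S, Tendsto
        (fun k : ℕ => (incidence (blockSubst σ m) S ^ k) u v / theta σ F i ^ k) atTop
        (𝓝 (headWeight x u * δ v))) {a : A} (ha : a ∈ F i \ F (i - 1))
    (p : A → Prop) [DecidablePred p] {G : Finset (List A)} (hGS : G ⊆ S)
    (hG : ∀ b r, b :: r ∈ langOfLength σ (F i) m → (b :: r ∈ G ↔ p b)) :
    Tendsto (fun k : ℕ => ((iter σ k a).countP (fun b => p b) : ℝ) / theta σ F i ^ k) atTop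
      (𝓝 (x a * ∑ w : S with w.1 ∈ G, δ w)) := by
  have hli := h.lt
  obtain ⟨t, ht⟩ := h.components.exists_cons_mem (by omega) h.le h.one_lt h.one_le ha
  have hu := h.cons_mem hS ha ht
  have h1 : Tendsto (fun k : ℕ => ∑ w : S with w.1 ∈ G,
      (incidence (blockSubst σ m) S ^ k) ⟨_, hu⟩ w / theta σ F i ^ k) atTop
      (𝓝 (∑ w : S with w.1 ∈ G, headWeight x (a :: t) * δ w)) :=
    tendsto_finsetSum _ fun w _ => hlim ⟨_, hu⟩ w
  rw [← Finset.mul_sum] at h1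
  refine h1.congr fun k => ?_
  rw [← Finset.sum_div]
  congr 1
  simp only [h.pow_apply hS]
  rw [Finset.sum_filter, Finset.sum_coe_sort S fun w =>
    if w ∈ G then (blockOcc σ w k (a :: t) : ℝ) else 0, Finset.sum_ite_mem,
    Finset.inter_eq_right.2 hGS]
  have hmemL : ∀ u ∈ G, u ∈ langOfLength σ (F i) m := fun u huG => by
    have := hGS huG
    rw [hS] at this
    exact (Finset.mem_sdiff.1 this).1
  have h2 := sum_occWith (m := m) h.one_le p G
    (fun u huG => (h.exists_cons_of_mem hS (hGS huG)).1) (fun u huG => by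
      obtain ⟨-, -, b, r, rfl, -⟩ := h.exists_cons_of_mem hS (hGS huG)
      exact ⟨b, r, rfl, (hG b r (hmemL _ huG)).1 huG⟩)
    (iter σ k a) ((substWord σ)^[k] t) (by
      have h3 := length_le_length_iterate h.components.ne_nil k t
      have h4 := (mem_langOfLength.1 ht).1
      rw [List.length_cons] at h4
      omega)
    (fun b r hbr hlen hb => by
      refine (hG b r (mem_langOfLength.2 ⟨hlen, ?_⟩)).2 hb
      rw [← iterate_substWord_cons] at hbr
      exact lang_of_infix (iterate_mem_lang (mem_langOfLength.1 ht).2 k) hbr)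
  rw [← h2]
  push_cast
  rfl

/-- A left eigenvector for the dominant eigenvalue is a multiple of `δ`. -/
theorem eq_mul_of_isLeftEigenvector (h : IsDominantRange σ n F i l m)
    (hlim : ∀ u v : S, Tendsto
        (fun k : ℕ => (incidence (blockSubst σ m) S ^ k) u v / theta σ F i ^ k) atTop
        (𝓝 (headWeight x u * δ v))) {β : S → ℝ}
    (hβ : IsLeftEigenvector (incidence (blockSubst σ m) S) (theta σ F i) β) :
    ∃ c : ℝ, c ≠ 0 ∧ ∀ v, β v = c * δ v := by
  have hθ : 0 < theta σ F i := one_pos.trans h.one_lt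
  -- `β` is fixed by every `M ^ k / θ_i^k`, hence by the rank-one limit.
  have heq : ∀ v, β v = (∑ w : S, β w * headWeight x w) * δ v := by
    intro v
    have h1 : Tendsto (fun k : ℕ => ∑ w : S,
        β w * ((incidence (blockSubst σ m) S ^ k) w v / theta σ F i ^ k)) atTop
        (𝓝 (∑ w : S, β w * (headWeight x w * δ v))) :=
      tendsto_finsetSum _ fun w _ => (hlim w v).const_mul _
    have h2 : (fun k : ℕ => ∑ w : S,
        β w * ((incidence (blockSubst σ m) S ^ k) w v / theta σ F i ^ k)) = fun _ => β v := by
      ext k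
      have h3 := congrFun (vecMul_pow_of_eigenvector hβ.2 k) v
      simp only [Matrix.vecMul, dotProduct, Pi.smul_apply, smul_eq_mul] at h3
      simp only [← mul_div_assoc]
      rw [← Finset.sum_div, h3, mul_div_cancel_left₀ _ (pow_pos hθ k).ne']
    rw [h2] at h1
    rw [tendsto_nhds_unique tendsto_const_nhds h1, Finset.sum_mul]
    exact Finset.sum_congr rfl fun w _ => by ring
  refine ⟨_, fun hc => hβ.1 ?_, heq⟩
  ext v
  rw [heq v, hc, zero_mul]
  rfl

end IsDominantRange

end Asymptotics

end PrimitiveComponents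


/-! ### The limits for words in the iterates of a letter -/

theorem corollary5p1 {A : Type*} [Fintype A] [DecidableEq A]
    (σ : A → List A) (n : ℕ) (F : ℕ → Finset A)
    (hσ : IsOfPrimitiveComponents σ n F)
    (i : ℕ) (hi : 1 < i) (hin : i ≤ n)
    (hθ : 1 < theta σ F i)
    (m : ℕ) (hm : 1 ≤ m) :
    -- (i)
    (lam σ F (i - 1) < theta σ F i →
      (∃ β : langOfLength σ (F i) m → ℝ, (∀ w, 0 < β w) ∧
        IsLeftEigenvector (incidence (blockSubst σ m) (langOfLength σ (F i) m))
          (theta σ F i) β) ∧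
      ∀ β : langOfLength σ (F i) m → ℝ,
        IsLeftEigenvector (incidence (blockSubst σ m) (langOfLength σ (F i) m))
          (theta σ F i) β →
        ∀ a ∈ F i \ F (i - 1), ∀ v : langOfLength σ (F i) m,
          Tendsto (fun k : ℕ => (occ (v : List A) (iter σ k a) : ℝ) / ((iter σ k a).length : ℝ))
            atTop (𝓝 (β v / ∑ w, β w))) ∧
    ∃ δ : deltaWords σ F i m → ℝ, (∀ v, 0 < δ v) ∧
      IsLeftEigenvector (incidence (blockSubst σ m) (deltaWords σ F i m)) (theta σ F i) δ ∧
      -- (ii)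
      (theta σ F i ≤ lam σ F (i - 1) →
        ∃ γ : gammaWords σ F i m → ℝ, (∀ u, 0 < γ u) ∧
          ∀ a ∈ F i \ F (i - 1),
            (∀ v ∈ langOfLength σ (F (iPrime σ F i - 1)) m,
              Tendsto (fun k : ℕ => 1 / theta σ F i ^ k * (occ v (iter σ k a) : ℝ))
                atTop atTop) ∧
            ∀ v : deltaWords σ F i m, ∀ u : gammaWords σ F i m, (u : List A).head? = some a →
              Tendsto (fun k : ℕ => 1 / theta σ F i ^ k * (occ (v : List A) (iter σ k a) : ℝ))
                atTop (𝓝 (γ u * δ v))) ∧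
      -- (iii)
      ∀ a ∈ F i \ F (i - 1), ∀ v : deltaWords σ F i m,
        Tendsto (fun k : ℕ => (occ (v : List A) (iter σ k a) : ℝ) /
            ∑ b ∈ F i \ F (i - 1), (occ [b] (iter σ k a) : ℝ))
          atTop (𝓝 (δ v / ∑ w : deltaWords σ F i m with w.1 ∈ gammaWords σ F i m, δ w)) := by
  have hin1 : 1 ≤ i := hi.le
  have hθ0 : 0 < theta σ F i := one_pos.trans hθ
  refine ⟨fun hlam => ?_, ?_⟩
  · have h : IsDominantRange σ n F i 0 m := ⟨hσ, by omega, hin, hθ, fun j hj hji =>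
      (theta_le_lam σ F hj (by omega)).trans_lt hlam, hm⟩
    -- `F 0` is empty, so level `l = 0` removes no words.
    have hS : langOfLength σ (F i) m = langOfLength σ (F i) m \ langOfLength σ (F 0) m := by
      rw [eq_comm, Finset.sdiff_eq_self_iff_disjoint, Finset.disjoint_right]
      intro w hw
      obtain ⟨-, k, -, a, ha, -⟩ := mem_langOfLength.1 hw
      simp [hσ.bot] at ha
    obtain ⟨x, hx, δ, hδ, hδeig, hlim⟩ := h.exists_tendsto hS
    refine ⟨⟨δ, hδ, hδeig⟩, fun β hβ a ha v => ?_⟩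
    obtain ⟨c, hc, hβδ⟩ := h.eq_mul_of_isLeftEigenvector hlim hβ
    have h1 := h.tendsto_occ hS hlim ha v
    have h2 := h.tendsto_countP hS hlim ha (fun _ => True) (G := langOfLength σ (F i) m)
      subset_rfl fun b r hbr => by simp [hbr]
    have hsum : 0 < ∑ w : langOfLength σ (F i) m with w.1 ∈ langOfLength σ (F i) m, δ w :=
      Finset.sum_pos (fun w _ => hδ w) ⟨v, by simp⟩
    have h3 := h1.div h2 (mul_pos (hx a ha) hsum).ne'
    rw [Finset.filter_true_of_mem fun w _ => w.2, mul_div_mul_left _ _ (hx a ha).ne'] at h3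
    simp only [hβδ, ← Finset.mul_sum, mul_div_mul_left _ _ hc]
    refine h3.congr fun k => ?_
    rw [Pi.div_apply, div_div_div_cancel_right₀ (pow_pos hθ0 k).ne']
    simp
  · obtain ⟨hlt, hbelow, hcase⟩ := iPrime_spec σ F hi
    have h : IsDominantRange σ n F i (iPrime σ F i - 1) m := ⟨hσ, hlt, hin, hθ, hbelow, hm⟩
    obtain ⟨x, hx, δ, hδ, hδeig, hlim⟩ := h.exists_tendsto (S := deltaWords σ F i m) rfl
    have hgamma : ∀ b r, b :: r ∈ langOfLength σ (F i) m →
        (b :: r ∈ gammaWords σ F i m ↔ b ∈ F i \ F (i - 1)) := by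
      intro b r hbr
      have hb := hσ.mem_of_mem_lang hin (mem_langOfLength.1 hbr).2 (b := b) (by simp)
      simp [startWords, Nat.sub_add_cancel hin1, hbr, hb]
    -- `γ_u` is the Perron weight of the first letter of `u`.
    refine ⟨δ, hδ, hδeig, fun hlam => ⟨fun u => headWeight x u, ?_, fun a ha => ⟨?_, ?_⟩⟩, ?_⟩
    · rintro ⟨u, hu⟩
      have huL := (Finset.mem_sdiff.1 hu).1
      cases u with
      | nil =>
        have := (mem_langOfLength.1 huL).1
        rw [List.length_nil] at this
        omega
      | cons b r => exact hx b ((hgamma b r huL).1 hu)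
    · intro v hv
      have hv0 : v ≠ [] := by
        rintro rfl
        have := (mem_langOfLength.1 hv).1
        rw [List.length_nil] at this
        omega
      -- If `i' = 1`, all lower eigenvalues are below `θ_i`, hence so is their maximum, against
      -- `hlam`.
      have hl0 : iPrime σ F i - 1 ≠ 0 := fun h0 => by
        rw [h0] at hbelow
        exact hlam.not_gt (lam_lt σ F (by omega) fun j hj hji => hbelow j (by omega) (by omega))
      simp only [occ_eq_occWith]
      exact hσ.tendsto_occWith_atTop (by omega) hlt hin (hcase.resolve_left hl0)
        (mem_langOfLength.1 hv).2 hv0 ha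
    · rintro v ⟨u, hu⟩ hua
      obtain ⟨r, rfl⟩ : ∃ r, u = a :: r := by
        cases u with
        | nil => simp at hua
        | cons b r => exact ⟨r, by simpa using hua⟩
      refine (h.tendsto_occ rfl hlim ha v).congr fun k => ?_
      rw [one_div, inv_mul_eq_div]
    · intro a ha v
      obtain ⟨t, ht⟩ := hσ.exists_cons_mem hin1 hin hθ hm ha
      have hsub : gammaWords σ F i m ⊆ deltaWords σ F i m := by
        intro u hu
        have huL := (Finset.mem_sdiff.1 hu).1
        cases u with
        | nil =>
          have := (mem_langOfLength.1 huL).1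
          rw [List.length_nil] at this
          omega
        | cons b r => exact h.cons_mem rfl ((hgamma b r huL).1 hu) huL
      have htG := (hgamma a t ht).2 ha
      have h1 := h.tendsto_occ rfl hlim ha v
      have h2 := h.tendsto_countP rfl hlim ha (fun b => b ∈ F i \ F (i - 1)) hsub hgamma
      have hsum : 0 < ∑ w : deltaWords σ F i m with w.1 ∈ gammaWords σ F i m, δ w :=
        Finset.sum_pos (fun w _ => hδ w) ⟨⟨a :: t, hsub htG⟩, by simpa using htG⟩
      have h3 := h1.div h2 (mul_pos (hx a ha) hsum).ne'
      rw [mul_div_mul_left _ _ (hx a ha).ne'] at h3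
      refine h3.congr fun k => ?_
      rw [Pi.div_apply, div_div_div_cancel_right₀ (pow_pos hθ0 k).ne', ← sum_count_eq_countP]
      simp only [occ_eq_occWith, occWith_singleton]
      push_cast
      rfl
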